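/- Theorem 3. Let $N\ge 5$ be an integer, $a\ge 0$ and $1<p<\frac{N+4+2a}{N-4}$. Then there is no function $u\in C^4(\mathbb{R}^N)$ with $u>0$ everywhere on $\mathbb{R}^N$ that solves the fourth-order Hénon equation $$\Delta^2 u=|x|^a u^p\quad\text{in } \mathbb{R}^N$$ and has finite Morse index. Here, for $\phi\in C_c^4(\mathbb{R}^N)$, put $$I_{uu}(\phi)=\int_{\mathbb{R}^N}|\Delta\phi|^2\,dx-p\int_{\mathbb{R}^N}|x|^a u^{p-1}\phi^2\,dx .$$ The Morse index of $u$ is the maximal dimension of a linear subspace $X\subset C_c^4(\mathbb{R}^N)$ such that $I_{uu}(\phi)<0$ for all $\phi\in X\setminus\{0\}$, and $u$ has finite Morse index if this maximum is a finite number (it is $0$ exactly when $u$ is stable, i.e. $I_{uu}\ge 0$ on $C_c^4(\mathbb{R}^N)$). -/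

import Mathlib

open scoped Laplacian

/-- `u` is a positive classical (that is, `C⁴`) solution on `ℝᴺ` of the fourth-order Hénon equation
`Δ² u = |x|ᵃ uᵖ`. -/
structure IsPositiveHenonSolution (N : ℕ) (a p : ℝ)
    (u : EuclideanSpace ℝ (Fin N) → ℝ) : Prop where
  contDiff : ContDiff ℝ 4 u
  pos : ∀ x, 0 < u x
  eqn : ∀ x, (Δ (Δ u)) x = ‖x‖ ^ a * u x ^ p

/-- The second variation at `u` of the energy
`∫ (1/2) |Δ u|² - (1/(p+1)) ∫ |x|ᵃ uᵖ⁺¹`, as a quadratic form in the test function `φ`: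
`∫ |Δ φ|² - p ∫ |x|ᵃ uᵖ⁻¹ φ²`. -/
noncomputable def henonSecondVariation (N : ℕ) (a p : ℝ)
    (u φ : EuclideanSpace ℝ (Fin N) → ℝ) : ℝ :=
  (∫ x, (Δ φ) x ^ 2) - p * ∫ x, ‖x‖ ^ a * u x ^ (p - 1) * φ x ^ 2

/-- `X` is a linear space of compactly supported `C⁴` functions on `ℝᴺ`, and the second variation
at `u` is negative on `X ∖ {0}`. -/
structure IsHenonNegativeSpace (N : ℕ) (a p : ℝ) (u : EuclideanSpace ℝ (Fin N) → ℝ)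
    (X : Submodule ℝ (EuclideanSpace ℝ (Fin N) → ℝ)) : Prop where
  contDiff : ∀ φ ∈ X, ContDiff ℝ 4 φ
  hasCompactSupport : ∀ φ ∈ X, HasCompactSupport φ
  neg : ∀ φ ∈ X, φ ≠ 0 → henonSecondVariation N a p u φ < 0

/-- `u` has Morse index `m`: `m` is the maximal dimension of a linear space of compactly supported
`C⁴` functions on whose nonzero elements the second variation at `u` is negative.
The index `0` means that `u` is stable. -/
def HasHenonMorseIndex (N : ℕ) (a p : ℝ) (u : EuclideanSpace ℝ (Fin N) → ℝ) (m : ℕ) : Prop :=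
  IsGreatest {d : ℕ | ∃ X : Submodule ℝ (EuclideanSpace ℝ (Fin N) → ℝ),
    FiniteDimensional ℝ X ∧ IsHenonNegativeSpace N a p u X ∧ Module.finrank ℝ X = d} m

/-- `u` has finite Morse index. -/
def HasFiniteHenonMorseIndex (N : ℕ) (a p : ℝ) (u : EuclideanSpace ℝ (Fin N) → ℝ) : Prop :=
  ∃ m : ℕ, HasHenonMorseIndex N a p u m

/-!
The argument has two halves. The first is that the solution has finite energy. A finite Morse
index makes `u` stable outside a ball: a maximal negative space consists of functions supported in
a fixed ball, and a negative direction supported away from that ball could be added to it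
(`exists_stable_outside_ball`). For a cutoff `ζ` vanishing on the ball, compare the stability
inequality for `u ζ` with the equation tested against `u ζ²`. Because `p > 1`, this bounds
`∫ (|Δu|² + |x|ᵃ uᵖ⁺¹) ζ²` by `∫ u² V`, where `V` is built from derivatives of `ζ`
(`exists_energy_le`); no sign of `Δu` is needed, since the only bad term, `u |Δu| |∇ζ|²`, is
absorbed by the Cauchy–Schwarz inequality. If `ζ` is a high power of a cutoff at scale `R`,
Young's inequality absorbs `u² V` into `|x|ᵃ uᵖ⁺¹ ζ²`, with a remainder of order `R ^ (N - κ)`,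
`κ = (4 (p + 1) + 2a) / (p - 1)` (`exists_young`). The hypothesis on `p` says exactly that `N < κ`,
so `|Δu|²` and `|x|ᵃ uᵖ⁺¹` are integrable (`integrable_energy`).

The second half is the Pohozaev identity. The equation is tested against
`(x · ∇u) χ + (N - 4) / 2 · u χ` with a cutoff `χ` at scale `R` (`pohozaev`). All terms containing
derivatives of `χ` live on the annulus `R ≤ |x| ≤ 2R` and are bounded by the integral over it of
`|Δu|² + |x|ᵃ uᵖ⁺¹ + R⁻⁴ u² + R⁻² |∇u|² + |D²u|²`. This tends to zero, by finite energy, Young's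
inequality, and interior estimates for the gradient and the Hessian (`tendsto_scaledDensity`).
What remains is `((N + a) / (p + 1) - (N - 4) / 2) ∫ |x|ᵃ uᵖ⁺¹ ≤ 0`. The constant is positive by
subcriticality, so the integral vanishes, against `u > 0`.

Integration by parts is always done in the form that the integral of the divergence of a compactly
supported field is zero, so that the analysis reduces to pointwise identities and inequalities
between coordinate expressions.
-/

open MeasureTheory Set Filter Topology

/-! ### Coordinate calculus on Euclidean space -/

section Calculus

variable {N : ℕ} {f g : EuclideanSpace ℝ (Fin N) → ℝ} {x : EuclideanSpace ℝ (Fin N)}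

/-- The partial derivative `∂ᵢ f`, with junk value `0` where `f` is not differentiable. -/
noncomputable def pd (i : Fin N) (f : EuclideanSpace ℝ (Fin N) → ℝ) :
    EuclideanSpace ℝ (Fin N) → ℝ :=
  fun x => fderiv ℝ f x (EuclideanSpace.single i 1)

/-- `∇f · ∇g`, in coordinates. -/
noncomputable def gradDot (f g : EuclideanSpace ℝ (Fin N) → ℝ) :
    EuclideanSpace ℝ (Fin N) → ℝ :=
  fun x => ∑ i, pd i f x * pd i g x

/-- The Laplacian `∑ᵢ ∂ᵢ∂ᵢ f` in coordinates; it agrees with `Δ f` on `C²` functions. -/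
noncomputable def lap (f : EuclideanSpace ℝ (Fin N) → ℝ) : EuclideanSpace ℝ (Fin N) → ℝ :=
  fun x => ∑ i, pd i (pd i f) x

/-- The squared Hilbert–Schmidt norm `|D²f|²` of the Hessian. -/
noncomputable def hessSq (f : EuclideanSpace ℝ (Fin N) → ℝ) : EuclideanSpace ℝ (Fin N) → ℝ :=
  fun x => ∑ i, ∑ j, pd j (pd i f) x ^ 2

/-- The radial derivative `x · ∇f`. -/
noncomputable def radial (f : EuclideanSpace ℝ (Fin N) → ℝ) : EuclideanSpace ℝ (Fin N) → ℝ :=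
  fun x => ∑ i, x i * pd i f x

theorem ContDiff.pd {n m : WithTop ℕ∞} (hf : ContDiff ℝ n f) (h : m + 1 ≤ n) (i : Fin N) :
    ContDiff ℝ m (pd i f) :=
  (hf.fderiv_right h).clm_apply contDiff_const

theorem ContDiff.pd_pd {n m : WithTop ℕ∞} (hf : ContDiff ℝ n f) (h : m + 2 ≤ n) (i j : Fin N) :
    ContDiff ℝ m (_root_.pd j (_root_.pd i f)) :=
  (hf.pd (m := m + 1) (by rwa [add_assoc, one_add_one_eq_two]) i).pd le_rfl j

theorem ContDiff.gradDot {n m : WithTop ℕ∞} (hf : ContDiff ℝ n f) (hg : ContDiff ℝ n g)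
    (h : m + 1 ≤ n) : ContDiff ℝ m (gradDot f g) :=
  ContDiff.sum fun i _ => (hf.pd h i).mul (hg.pd h i)

theorem ContDiff.lap {n m : WithTop ℕ∞} (hf : ContDiff ℝ n f) (h : m + 2 ≤ n) :
    ContDiff ℝ m (lap f) :=
  ContDiff.sum fun i _ => hf.pd_pd h i i

theorem ContDiff.hessSq {n m : WithTop ℕ∞} (hf : ContDiff ℝ n f) (h : m + 2 ≤ n) :
    ContDiff ℝ m (hessSq f) :=
  ContDiff.sum fun i _ => ContDiff.sum fun j _ => (hf.pd_pd h i j).pow 2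

theorem contDiff_coord {n : WithTop ℕ∞} (i : Fin N) :
    ContDiff ℝ n (fun x : EuclideanSpace ℝ (Fin N) => x i) := by
  fun_prop

theorem ContDiff.radial {n m : WithTop ℕ∞} (hf : ContDiff ℝ n f) (h : m + 1 ≤ n) :
    ContDiff ℝ m (radial f) :=
  ContDiff.sum fun i _ => (contDiff_coord i).mul (hf.pd h i)

theorem pd_congr (h : f =ᶠ[𝓝 x] g) (i : Fin N) : pd i f x = pd i g x := by
  simp only [pd, h.fderiv_eq]

theorem pd_eventuallyEq (h : f =ᶠ[𝓝 x] g) (i : Fin N) : pd i f =ᶠ[𝓝 x] pd i g := by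
  filter_upwards [h.eventuallyEq_nhds] with y hy using pd_congr hy i

theorem gradDot_congr {f' g' : EuclideanSpace ℝ (Fin N) → ℝ} (h : f =ᶠ[𝓝 x] f')
    (h' : g =ᶠ[𝓝 x] g') : gradDot f g x = gradDot f' g' x := by
  simp only [gradDot, pd_congr h, pd_congr h']

theorem lap_congr (h : f =ᶠ[𝓝 x] g) : lap f x = lap g x := by
  simp only [lap, pd_congr (pd_eventuallyEq h _)]

theorem hessSq_congr (h : f =ᶠ[𝓝 x] g) : hessSq f x = hessSq g x := by
  simp only [hessSq, pd_congr (pd_eventuallyEq h _)]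

@[simp] theorem pd_const (i : Fin N) (c : ℝ) :
    pd i (fun _ : EuclideanSpace ℝ (Fin N) => c) = fun _ => 0 := by
  ext x; simp [pd]

theorem pd_add (hf : Differentiable ℝ f) (hg : Differentiable ℝ g) (i : Fin N) :
    pd i (fun x => f x + g x) = fun x => pd i f x + pd i g x := by
  ext x; simp [pd, fderiv_fun_add (hf x) (hg x)]

theorem pd_sub (hf : Differentiable ℝ f) (hg : Differentiable ℝ g) (i : Fin N) :
    pd i (fun x => f x - g x) = fun x => pd i f x - pd i g x := by
  ext x; simp [pd, fderiv_fun_sub (hf x) (hg x)]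

theorem pd_mul (hf : Differentiable ℝ f) (hg : Differentiable ℝ g) (i : Fin N) :
    pd i (fun x => f x * g x) = fun x => pd i f x * g x + f x * pd i g x := by
  ext x; simp [pd, fderiv_fun_mul (hf x) (hg x)]; ring

theorem pd_const_mul (c : ℝ) (hf : Differentiable ℝ f) (i : Fin N) :
    pd i (fun x => c * f x) = fun x => c * pd i f x := by
  ext x; simp [pd, fderiv_const_mul (hf x)]

theorem pd_pow (hf : Differentiable ℝ f) (n : ℕ) (i : Fin N) :
    pd i (fun x => f x ^ n) = fun x => n * f x ^ (n - 1) * pd i f x := by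
  ext x; simp [pd, fderiv_fun_pow n (hf x)]

theorem pd_sum {ι : Type*} (s : Finset ι) {f : ι → EuclideanSpace ℝ (Fin N) → ℝ}
    (hf : ∀ k, Differentiable ℝ (f k)) (i : Fin N) :
    pd i (fun x => ∑ k ∈ s, f k x) = fun x => ∑ k ∈ s, pd i (f k) x := by
  ext x; simp [pd, fderiv_fun_sum fun k (_ : k ∈ s) => hf k x]

theorem pd_coord (i j : Fin N) :
    pd i (fun x : EuclideanSpace ℝ (Fin N) => x j) = fun _ => if j = i then 1 else 0 := by
  ext x
  have : HasFDerivAt (fun x : EuclideanSpace ℝ (Fin N) => x j)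
      (EuclideanSpace.proj j : EuclideanSpace ℝ (Fin N) →L[ℝ] ℝ) x :=
    (EuclideanSpace.proj j : EuclideanSpace ℝ (Fin N) →L[ℝ] ℝ).hasFDerivAt
  simp [pd, this.fderiv]

theorem pd_pd_apply (hf : ContDiff ℝ 2 f) (k l : Fin N) (x) : pd k (pd l f) x =
    fderiv ℝ (fderiv ℝ f) x (EuclideanSpace.single k 1) (EuclideanSpace.single l 1) := by
  have hd : DifferentiableAt ℝ (fderiv ℝ f) x :=
    (hf.fderiv_right (m := 1) (by norm_num)).differentiable (by norm_num) x
  have h := hd.hasFDerivAt.clm_apply (hasFDerivAt_const (EuclideanSpace.single l (1 : ℝ)) x)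
  change fderiv ℝ (fun y => fderiv ℝ f y (EuclideanSpace.single l 1)) x _ = _
  rw [h.fderiv]
  simp

theorem pd_comm (hf : ContDiff ℝ 2 f) (i j : Fin N) : pd i (pd j f) = pd j (pd i f) := by
  ext x
  rw [pd_pd_apply hf, pd_pd_apply hf]
  exact (hf.contDiffAt.isSymmSndFDerivAt (by simp)) _ _

theorem laplacian_eq_lap (hf : ContDiff ℝ 2 f) : Δ f = lap f := by
  ext x
  rw [InnerProductSpace.laplacian_eq_iteratedFDeriv_orthonormalBasis f
    (EuclideanSpace.basisFun (Fin N) ℝ)]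
  simp [lap, iteratedFDeriv_two_apply, pd_pd_apply hf]

theorem gradDot_comm (f g : EuclideanSpace ℝ (Fin N) → ℝ) : gradDot f g = gradDot g f := by
  ext x; simp only [gradDot, mul_comm]

theorem gradDot_self_nonneg (f : EuclideanSpace ℝ (Fin N) → ℝ) (x) : 0 ≤ gradDot f f x :=
  Finset.sum_nonneg fun _ _ => mul_self_nonneg _

theorem hessSq_nonneg (f : EuclideanSpace ℝ (Fin N) → ℝ) (x) : 0 ≤ hessSq f x :=
  Finset.sum_nonneg fun _ _ => Finset.sum_nonneg fun _ _ => sq_nonneg _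

theorem gradDot_sq_le (f g : EuclideanSpace ℝ (Fin N) → ℝ) (x) :
    gradDot f g x ^ 2 ≤ gradDot f f x * gradDot g g x := by
  simpa only [gradDot, ← sq] using
    Finset.sum_mul_sq_le_sq_mul_sq Finset.univ (fun i => pd i f x) (fun i => pd i g x)

theorem lap_sq_le (f : EuclideanSpace ℝ (Fin N) → ℝ) (x) :
    lap f x ^ 2 ≤ N * hessSq f x := by
  have h1 : lap f x ^ 2 ≤ N * ∑ i, pd i (pd i f) x ^ 2 := by
    simpa [lap] using sq_sum_le_card_mul_sum_sq (s := (Finset.univ : Finset (Fin N)))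
      (f := fun i => pd i (pd i f) x)
  refine h1.trans (mul_le_mul_of_nonneg_left ?_ (Nat.cast_nonneg _))
  exact Finset.sum_le_sum fun i _ =>
    Finset.single_le_sum (f := fun j => pd j (pd i f) x ^ 2) (fun _ _ => sq_nonneg _)
      (Finset.mem_univ i)

theorem gradDot_mul_right {h : EuclideanSpace ℝ (Fin N) → ℝ}
    (hf : Differentiable ℝ f) (hg : Differentiable ℝ g) :
    gradDot h (fun x => f x * g x) = fun x => f x * gradDot h g x + g x * gradDot h f x := by
  ext x
  simp only [gradDot, pd_mul hf hg, Finset.mul_sum, ← Finset.sum_add_distrib]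
  exact Finset.sum_congr rfl fun i _ => by ring

theorem lap_mul (hf : ContDiff ℝ 2 f) (hg : ContDiff ℝ 2 g) :
    lap (fun x => f x * g x) = fun x => f x * lap g x + 2 * gradDot f g x + g x * lap f x := by
  have df := hf.differentiable (by norm_num)
  have dg := hg.differentiable (by norm_num)
  have dpf := fun i => (hf.pd (m := 1) (by norm_num) i).differentiable (by norm_num)
  have dpg := fun i => (hg.pd (m := 1) (by norm_num) i).differentiable (by norm_num)
  ext x
  simp only [lap, gradDot, pd_mul df dg, Finset.mul_sum, ← Finset.sum_add_distrib]
  refine Finset.sum_congr rfl fun i _ => ?_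
  rw [pd_add ((dpf i).fun_mul dg) (df.fun_mul (dpg i)), pd_mul (dpf i) dg, pd_mul df (dpg i)]
  ring

theorem lap_pow_two (hf : ContDiff ℝ 2 f) :
    lap (fun x => f x ^ 2) = fun x => 2 * f x * lap f x + 2 * gradDot f f x := by
  have : (fun x => f x ^ 2) = fun x => f x * f x := by ext x; ring
  rw [this, lap_mul hf hf]; ext x; ring

theorem lap_sum {ι : Type*} (s : Finset ι) {f : ι → EuclideanSpace ℝ (Fin N) → ℝ}
    (hf : ∀ k, ContDiff ℝ 2 (f k)) :
    lap (fun x => ∑ k ∈ s, f k x) = fun x => ∑ k ∈ s, lap (f k) x := by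
  ext x
  simp only [lap]
  rw [Finset.sum_comm]
  refine Finset.sum_congr rfl fun i _ => ?_
  rw [pd_sum s (fun k => (hf k).differentiable (by norm_num)),
    pd_sum s (fun k => ((hf k).pd (m := 1) (by norm_num) i).differentiable (by norm_num))]

theorem pd_lap (hf : ContDiff ℝ 3 f) (i : Fin N) : pd i (lap f) = lap (pd i f) := by
  have h2 : ContDiff ℝ 2 f := hf.of_le (by norm_num)
  change pd i (fun x => ∑ k, pd k (pd k f) x) = _
  rw [pd_sum _ (fun k => (hf.pd_pd (m := 1) (by norm_num) k k).differentiable (by norm_num))]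
  ext x
  refine Finset.sum_congr rfl fun k _ => ?_
  rw [pd_comm (hf.pd (m := 2) (by norm_num) k), pd_comm h2 i k]

/-- `Δ(x · ∇f) = 2 Δf + x · ∇(Δf)`. -/
theorem lap_radial (hf : ContDiff ℝ 3 f) :
    lap (radial f) = fun x => 2 * lap f x + radial (lap f) x := by
  have hp : ∀ k, ContDiff ℝ 2 (pd k f) := fun k => hf.pd (by norm_num) k
  change lap (fun x => ∑ k, x k * pd k f x) = _
  rw [lap_sum _ fun k => (contDiff_coord k).mul (hp k)]
  ext x
  simp only [lap_mul (contDiff_coord _) (hp _), radial, pd_lap hf]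
  have h1 : ∀ k, lap (fun x : EuclideanSpace ℝ (Fin N) => x k) x = 0 := fun k => by
    simp [lap, pd_coord]
  have h2 : ∀ k, gradDot (fun x : EuclideanSpace ℝ (Fin N) => x k) (pd k f) x
      = pd k (pd k f) x := fun k => by
    simp [gradDot, pd_coord]
  simp only [h1, h2, mul_zero, add_zero, Finset.sum_add_distrib, ← Finset.mul_sum]
  rw [add_comm]; rfl

theorem pd_radial (hf : ContDiff ℝ 2 f) (i : Fin N) :
    pd i (radial f) = fun x => pd i f x + ∑ j, x j * pd i (pd j f) x := by
  have hp : ∀ k, Differentiable ℝ (pd k f) := fun k =>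
    (hf.pd (m := 1) (by norm_num) k).differentiable (by norm_num)
  have hc : ∀ k, Differentiable ℝ (fun x : EuclideanSpace ℝ (Fin N) => x k) := fun k =>
    (contDiff_coord (n := 1) k).differentiable (by norm_num)
  change pd i (fun x => ∑ k, x k * pd k f x) = _
  rw [pd_sum _ fun k => (hc k).fun_mul (hp k)]
  ext x
  simp [pd_mul (hc _) (hp _), pd_coord, Finset.sum_add_distrib]

theorem sum_coord_sq (x : EuclideanSpace ℝ (Fin N)) : ∑ i, x i ^ 2 = ‖x‖ ^ 2 :=
  (EuclideanSpace.real_norm_sq_eq x).symm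

theorem radial_sq_le (f : EuclideanSpace ℝ (Fin N) → ℝ) (x) :
    radial f x ^ 2 ≤ ‖x‖ ^ 2 * gradDot f f x := by
  rw [← sum_coord_sq]
  simpa only [gradDot, radial, ← sq] using
    Finset.sum_mul_sq_le_sq_mul_sq Finset.univ (fun i => x i) (fun i => pd i f x)

/-! ### Supports and the divergence theorem -/

theorem eq_zero_nhds_of_notMem_tsupport (h : x ∉ tsupport f) : f =ᶠ[𝓝 x] fun _ => 0 :=
  notMem_tsupport_iff_eventuallyEq.mp h

theorem pd_zero_of_notMem (h : x ∉ tsupport f) (i : Fin N) : pd i f x = 0 := by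
  rw [pd_congr (eq_zero_nhds_of_notMem_tsupport h), pd_const]

theorem pd_pd_zero_of_notMem (h : x ∉ tsupport f) (i j : Fin N) : pd j (pd i f) x = 0 := by
  have := pd_eventuallyEq (eq_zero_nhds_of_notMem_tsupport h) i
  rw [pd_const] at this
  rw [pd_congr this, pd_const]

theorem lap_zero_of_notMem (h : x ∉ tsupport f) : lap f x = 0 := by
  simp [lap, pd_pd_zero_of_notMem h]

theorem hessSq_zero_of_notMem (h : x ∉ tsupport f) : hessSq f x = 0 := by
  simp [hessSq, pd_pd_zero_of_notMem h]

theorem gradDot_zero_of_notMem (h : x ∉ tsupport f) (g) : gradDot g f x = 0 := by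
  simp [gradDot, pd_zero_of_notMem h]

theorem gradDot_zero_of_notMem_left (h : x ∉ tsupport f) (g) : gradDot f g x = 0 := by
  simp [gradDot, pd_zero_of_notMem h]

theorem zero_of_notMem (h : x ∉ tsupport f) : f x = 0 := image_eq_zero_of_notMem_tsupport h

theorem radial_zero_of_notMem (h : x ∉ tsupport f) : radial f x = 0 := by
  simp [radial, pd_zero_of_notMem h]

theorem HasCompactSupport.pd (hf : HasCompactSupport f) (i : Fin N) : HasCompactSupport (pd i f) :=
  HasCompactSupport.intro hf.isCompact fun _ hx => pd_zero_of_notMem hx i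

theorem integral_pd_eq_zero_of_integrable {f : EuclideanSpace ℝ (Fin N) → ℝ}
    (hf : Differentiable ℝ f) (hc : HasCompactSupport f) (i : Fin N) (hi : Integrable (pd i f)) :
    ∫ x, pd i f x = 0 := by
  have hi' : Integrable (fun x => fderiv ℝ f x (EuclideanSpace.single i 1)) := hi
  have h := integral_mul_fderiv_eq_neg_fderiv_mul_of_integrable (μ := volume)
    (f := fun _ : EuclideanSpace ℝ (Fin N) => (1 : ℝ)) (g := f)
    (v := EuclideanSpace.single i 1) (by simp) (by simpa only [one_mul] using hi')
    (by simpa using hf.continuous.integrable_of_hasCompactSupport hc)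
    (fun _ _ => differentiableAt_const _) (fun x _ => hf x)
  simp only [one_mul, fderiv_fun_const, Pi.zero_apply, zero_apply, zero_mul, integral_zero,
    neg_zero] at h
  exact h

theorem integral_pd_eq_zero (hf : ContDiff ℝ 1 f) (hc : HasCompactSupport f) (i : Fin N) :
    ∫ x, pd i f x = 0 :=
  integral_pd_eq_zero_of_integrable (hf.differentiable (by norm_num)) hc i
    ((hf.pd (m := 0) (by simp) i).continuous.integrable_of_hasCompactSupport (hc.pd i))

/-- The divergence theorem, as the comparison of integrands that agree up to a divergence. -/
theorem integral_eq_of_eq_add_div {A B : EuclideanSpace ℝ (Fin N) → ℝ}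
    {V : Fin N → EuclideanSpace ℝ (Fin N) → ℝ} (hB : Integrable B)
    (hV : ∀ i, ContDiff ℝ 1 (V i)) (hVc : ∀ i, HasCompactSupport (V i))
    (h : ∀ x, A x = B x + ∑ i, pd i (V i) x) : ∫ x, A x = ∫ x, B x := by
  have hi : ∀ i, Integrable (pd i (V i)) := fun i =>
    ((hV i).pd (m := 0) (by simp) i).continuous.integrable_of_hasCompactSupport ((hVc i).pd i)
  simp only [h]
  rw [integral_add hB (integrable_finsetSum _ fun i _ => hi i),
    integral_finsetSum _ fun i _ => hi i]
  simp [integral_pd_eq_zero (hV _) (hVc _)]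

theorem integral_le_of_le_add_div {A B : EuclideanSpace ℝ (Fin N) → ℝ}
    {V : Fin N → EuclideanSpace ℝ (Fin N) → ℝ} (hA : Integrable A) (hB : Integrable B)
    (hV : ∀ i, ContDiff ℝ 1 (V i)) (hVc : ∀ i, HasCompactSupport (V i))
    (h : ∀ x, A x ≤ B x + ∑ i, pd i (V i) x) : ∫ x, A x ≤ ∫ x, B x := by
  have hi : ∀ i, Integrable (pd i (V i)) := fun i =>
    ((hV i).pd (m := 0) (by simp) i).continuous.integrable_of_hasCompactSupport ((hVc i).pd i)
  rw [← integral_eq_of_eq_add_div hB hV hVc fun _ => rfl]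
  exact integral_mono hA (hB.add (integrable_finsetSum _ fun i _ => hi i)) h

theorem integrable_of_zero_off (hf : Continuous f) {K : Set (EuclideanSpace ℝ (Fin N))}
    (hK : IsCompact K) (h : ∀ x, x ∉ K → f x = 0) : Integrable f :=
  hf.integrable_of_hasCompactSupport (HasCompactSupport.intro hK h)

theorem integrable_lin_three {f g h : EuclideanSpace ℝ (Fin N) → ℝ} (hf : Integrable f)
    (hg : Integrable g) (hh : Integrable h) (a b c : ℝ) :
    Integrable fun x => a * f x + b * g x + c * h x :=
  ((hf.const_mul a).add (hg.const_mul b)).add (hh.const_mul c)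

theorem integral_lin_three {f g h : EuclideanSpace ℝ (Fin N) → ℝ} (hf : Integrable f)
    (hg : Integrable g) (hh : Integrable h) (a b c : ℝ) :
    ∫ x, (a * f x + b * g x + c * h x) = a * (∫ x, f x) + b * (∫ x, g x) + c * ∫ x, h x := by
  have hfg : Integrable fun x => a * f x + b * g x := (hf.const_mul a).add (hg.const_mul b)
  rw [integral_add hfg (hh.const_mul c), integral_add (hf.const_mul a) (hg.const_mul b),
    integral_const_mul, integral_const_mul, integral_const_mul]

/-- Green's second identity for a compactly supported factor. -/
theorem integral_lap_mul (hf : ContDiff ℝ 2 f) (hg : ContDiff ℝ 2 g) (hc : HasCompactSupport g) :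
    ∫ x, lap f x * g x = ∫ x, f x * lap g x := by
  have dpf := fun i => hf.pd (m := 1) (by norm_num) i
  have dpg := fun i => hg.pd (m := 1) (by norm_num) i
  have hf1 := hf.of_le (m := 1) (by norm_num)
  have hg1 := hg.of_le (m := 1) (by norm_num)
  have d : ∀ {h : EuclideanSpace ℝ (Fin N) → ℝ}, ContDiff ℝ 1 h → Differentiable ℝ h :=
    fun h => h.differentiable (by norm_num)
  refine integral_eq_of_eq_add_div (V := fun i x => pd i f x * g x - f x * pd i g x)
    (integrable_of_zero_off (hf.continuous.mul (hg.lap (m := 0) (by norm_num)).continuous)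
      hc.isCompact fun x hx => by simp [lap_zero_of_notMem hx])
    (fun i => ((dpf i).mul hg1).sub (hf1.mul (dpg i)))
    (fun i => HasCompactSupport.intro hc.isCompact fun x hx => by
      simp [zero_of_notMem hx, pd_zero_of_notMem hx]) fun x => ?_
  simp only [lap, Finset.mul_sum, Finset.sum_mul, ← Finset.sum_add_distrib]
  refine Finset.sum_congr rfl fun i _ => ?_
  rw [pd_sub ((d (dpf i)).fun_mul (d hg1)) ((d hf1).fun_mul (d (dpg i))), pd_mul (d (dpf i)) (d hg1),
    pd_mul (d hf1) (d (dpg i))]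
  ring

end Calculus

/-! ### Interior estimates for the gradient and the Hessian -/

section Interior

variable {N : ℕ} {u ξ ζ : EuclideanSpace ℝ (Fin N) → ℝ}

theorem sum_pd_mul_pd {f : EuclideanSpace ℝ (Fin N) → ℝ} (hf : ContDiff ℝ 1 f)
    (hu : ContDiff ℝ 2 u) (x) :
    ∑ i, pd i (fun x => f x * pd i u x) x = gradDot f u x + f x * lap u x := by
  have dpu := fun i => (hu.pd (m := 1) (by norm_num) i).differentiable (by norm_num)
  simp only [pd_mul (hf.differentiable (by norm_num)) (dpu _), gradDot, lap, Finset.mul_sum,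
    Finset.sum_add_distrib]

theorem gradDot_pow_two (hξ : Differentiable ℝ ξ) (x) :
    gradDot (fun x => ξ x ^ 2) u x = 2 * ξ x * gradDot ξ u x := by
  simp only [gradDot, pd_pow hξ, Finset.mul_sum]
  exact Finset.sum_congr rfl fun i _ => by norm_num; ring

theorem gradDot_mul_left {f g h : EuclideanSpace ℝ (Fin N) → ℝ}
    (hf : Differentiable ℝ f) (hg : Differentiable ℝ g) :
    gradDot (fun x => f x * g x) h = fun x => f x * gradDot g h x + g x * gradDot f h x := by
  rw [gradDot_comm, gradDot_mul_right hf hg, gradDot_comm g, gradDot_comm f]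

/-- A Caccioppoli inequality, from testing `Δu` against `u ξ²`. -/
theorem integral_sq_mul_gradDot_le (hu : ContDiff ℝ 2 u) (hξ : ContDiff ℝ 1 ξ)
    (hc : HasCompactSupport ξ) :
    ∫ x, ξ x ^ 2 * gradDot u u x ≤
      ∫ x, (4 * (u x ^ 2 * gradDot ξ ξ x) + 2 * (|u x| * |lap u x| * ξ x ^ 2)) := by
  have hu1 := hu.of_le (m := 1) (by norm_num)
  have du := hu.differentiable (by norm_num)
  have dξ := hξ.differentiable (by norm_num)
  have c1 := (hu.gradDot hu (m := 0) (by norm_num)).continuous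
  have c2 := (hξ.gradDot hξ (m := 0) (by norm_num)).continuous
  have c3 := (hu.lap (m := 0) (by norm_num)).continuous
  have hf : ContDiff ℝ 1 (fun x => 2 * (ξ x ^ 2 * u x)) :=
    contDiff_const.mul ((hξ.pow 2).mul hu1)
  refine integral_le_of_le_add_div (V := fun i x => (2 * (ξ x ^ 2 * u x)) * pd i u x)
    (integrable_of_zero_off ((hξ.continuous.pow 2).mul c1) hc.isCompact fun x hx => by
      simp [zero_of_notMem hx])
    (integrable_of_zero_off ((continuous_const.mul ((hu.continuous.pow 2).mul c2)).add
      (continuous_const.mul ((hu.continuous.abs.mul c3.abs).mul (hξ.continuous.pow 2))))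
      hc.isCompact fun x hx => by simp [zero_of_notMem hx, gradDot_zero_of_notMem hx])
    (fun i => hf.mul (hu.pd (by norm_num) i))
    (fun i => HasCompactSupport.intro hc.isCompact fun x hx => by simp [zero_of_notMem hx])
    fun x => ?_
  rw [sum_pd_mul_pd hf hu]
  have e1 : gradDot (fun x => 2 * (ξ x ^ 2 * u x)) u x
      = 2 * (ξ x ^ 2 * gradDot u u x + u x * (2 * ξ x * gradDot ξ u x)) := by
    rw [gradDot_mul_left (differentiable_const _) ((dξ.fun_pow 2).fun_mul du),
      gradDot_mul_left (dξ.fun_pow 2) du]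
    simp only [gradDot_pow_two dξ]
    simp [gradDot]
  have e2 : 0 ≤ 4 * (u x ^ 2 * gradDot ξ ξ x) + 4 * (ξ x * u x * gradDot ξ u x)
      + ξ x ^ 2 * gradDot u u x := by
    have : 4 * (u x ^ 2 * gradDot ξ ξ x) + 4 * (ξ x * u x * gradDot ξ u x)
      + ξ x ^ 2 * gradDot u u x = ∑ i, (2 * u x * pd i ξ x + ξ x * pd i u x) ^ 2 := by
      simp only [gradDot, Finset.mul_sum, ← Finset.sum_add_distrib]
      exact Finset.sum_congr rfl fun i _ => by ring
    rw [this]; exact Finset.sum_nonneg fun _ _ => sq_nonneg _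
  have e3 : 0 ≤ (|u x| * |lap u x| + u x * lap u x) * ξ x ^ 2 := by
    refine mul_nonneg ?_ (sq_nonneg _)
    rw [← abs_mul]; linarith [neg_abs_le (u x * lap u x)]
  rw [e1]
  nlinarith

/-- The Bochner formula. -/
theorem lap_gradDot_self (hu : ContDiff ℝ 3 u) (x) :
    lap (gradDot u u) x = 2 * hessSq u x + 2 * gradDot u (lap u) x := by
  have hp : ∀ k, ContDiff ℝ 2 (pd k u) := fun k => hu.pd (by norm_num) k
  change lap (fun x => ∑ k, pd k u x * pd k u x) x = _
  rw [lap_sum _ fun k => (hp k).mul (hp k)]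
  simp only [lap_mul (hp _) (hp _), gradDot, hessSq, pd_lap hu, Finset.mul_sum,
    ← Finset.sum_add_distrib]
  refine Finset.sum_congr rfl fun k _ => ?_
  rw [← Finset.mul_sum, ← Finset.mul_sum]
  simp only [← sq]
  ring

theorem gradDot_gradDot_self_le (hu : ContDiff ℝ 2 u) (x) :
    gradDot (gradDot u u) (gradDot u u) x ≤ 4 * (gradDot u u x * hessSq u x) := by
  have dpu := fun i => (hu.pd (m := 1) (by norm_num) i).differentiable (by norm_num)
  have e : ∀ i, pd i (gradDot u u) x = 2 * ∑ j, pd j u x * pd j (pd i u) x := by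
    intro i
    change pd i (fun x => ∑ k, pd k u x * pd k u x) x = _
    rw [pd_sum _ fun k => (dpu k).fun_mul (dpu k)]
    simp only [pd_mul (dpu _) (dpu _), Finset.mul_sum, pd_comm hu i]
    exact Finset.sum_congr rfl fun i _ => by ring
  have e2 : ∀ i, pd i (gradDot u u) x * pd i (gradDot u u) x
      ≤ 4 * (gradDot u u x * ∑ j, pd j (pd i u) x ^ 2) := by
    intro i
    have := Finset.sum_mul_sq_le_sq_mul_sq Finset.univ (fun j => pd j u x)
      (fun j => pd j (pd i u) x)
    rw [e]
    simp only [gradDot, ← sq]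
    nlinarith
  calc _ ≤ ∑ i, 4 * (gradDot u u x * ∑ j, pd j (pd i u) x ^ 2) :=
        Finset.sum_le_sum fun i _ => e2 i
    _ = _ := by simp only [hessSq, ← Finset.mul_sum]

/-- If `b² ≤ c d` with `c, d ≥ 0`, then `t b` is controlled by `c` and `d` through Young's
inequality. -/
theorem two_mul_mul_le_of_sq_le {t b c d : ℝ} (hc : 0 ≤ c) (hd : 0 ≤ d) (h : b ^ 2 ≤ c * d) :
    2 * (t * b) ≤ c + t ^ 2 * d := by
  have h1 : (t * b) ^ 2 ≤ c * (t ^ 2 * d) := by nlinarith [sq_nonneg t]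
  have h2 : 0 ≤ t ^ 2 * d := by positivity
  refine (le_abs_self _).trans (abs_le_of_sq_le_sq ?_ (by positivity))
  nlinarith [sq_nonneg (c - t ^ 2 * d)]

/-- The Hessian is controlled by the Laplacian in `L²`, up to a gradient term. -/
theorem integral_sq_mul_hessSq_le (hu : ContDiff ℝ 3 u) (hξ : ContDiff ℝ 1 ξ)
    (hc : HasCompactSupport ξ) :
    ∫ x, ξ x ^ 2 * hessSq u x ≤
      ∫ x, (4 * (ξ x ^ 2 * lap u x ^ 2) + 6 * (gradDot ξ ξ x * gradDot u u x)) := by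
  have hu2 := hu.of_le (m := 2) (by norm_num)
  have dξ := hξ.differentiable (by norm_num)
  have hl : ContDiff ℝ 1 (lap u) := hu.lap (by norm_num)
  have hg : ContDiff ℝ 2 (gradDot u u) := hu.gradDot hu (by norm_num)
  have c2 := (hξ.gradDot hξ (m := 0) (by norm_num)).continuous
  have hf : ContDiff ℝ 1 (fun x => ξ x ^ 2) := hξ.pow 2
  have hf' : ContDiff ℝ 1 (fun x => -2 * (ξ x ^ 2 * lap u x)) := contDiff_const.mul (hf.mul hl)
  have hV1 : ∀ i, ContDiff ℝ 1 (fun x => ξ x ^ 2 * pd i (gradDot u u) x) :=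
    fun i => hf.mul (hg.pd (by norm_num) i)
  have hV2 : ∀ i, ContDiff ℝ 1 (fun x => -2 * (ξ x ^ 2 * lap u x) * pd i u x) :=
    fun i => hf'.mul (hu.pd (by norm_num) i)
  refine integral_le_of_le_add_div
    (V := fun i x => ξ x ^ 2 * pd i (gradDot u u) x + (-2 * (ξ x ^ 2 * lap u x)) * pd i u x)
    (integrable_of_zero_off (hf.continuous.mul (hu.hessSq (m := 0) (by norm_num)).continuous)
      hc.isCompact fun x hx => by simp [zero_of_notMem hx])
    (integrable_of_zero_off ((continuous_const.mul (hf.continuous.mul (hl.continuous.pow 2))).add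
      (continuous_const.mul (c2.mul hg.continuous)))
      hc.isCompact fun x hx => by simp [zero_of_notMem hx, gradDot_zero_of_notMem hx])
    (fun i => (hV1 i).add (hV2 i))
    (fun i => HasCompactSupport.intro hc.isCompact fun x hx => by simp [zero_of_notMem hx])
    fun x => ?_
  simp only [pd_add ((hV1 _).differentiable (by norm_num)) ((hV2 _).differentiable (by norm_num)),
    Finset.sum_add_distrib]
  rw [sum_pd_mul_pd hf hg, sum_pd_mul_pd hf' hu2, lap_gradDot_self hu, gradDot_pow_two dξ,
    gradDot_mul_left (differentiable_const _) ((dξ.fun_pow 2).fun_mul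
      (hl.differentiable (by norm_num))),
    gradDot_mul_left (dξ.fun_pow 2) (hl.differentiable (by norm_num)), gradDot_comm u (lap u)]
  simp only [gradDot_pow_two dξ]
  have e0 : gradDot (fun _ => (-2 : ℝ)) u x = 0 := by simp [gradDot]
  rw [e0]
  have hG := gradDot_self_nonneg ξ x
  have hU := gradDot_self_nonneg u x
  have hH := hessSq_nonneg u x
  have e1 : 2 * (-ξ x * gradDot ξ (gradDot u u) x) ≤
      4 * gradDot ξ ξ x * gradDot u u x + (-ξ x) ^ 2 * hessSq u x := by
    refine two_mul_mul_le_of_sq_le (by positivity) hH ((gradDot_sq_le _ _ _).trans ?_)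
    have := mul_le_mul_of_nonneg_left (gradDot_gradDot_self_le hu2 x) hG
    nlinarith
  have e2 : 2 * ((ξ x * lap u x) * gradDot ξ u x) ≤
      gradDot ξ ξ x * gradDot u u x + (ξ x * lap u x) ^ 2 * 1 := by
    refine two_mul_mul_le_of_sq_le (by positivity) zero_le_one ?_
    rw [mul_one]; exact gradDot_sq_le _ _ _
  nlinarith

/-- The Caccioppoli inequality for the cutoffs `∂ₖζ`, summed over `k`. -/
theorem integral_gradDot_mul_gradDot_le (hu : ContDiff ℝ 2 u) (hζ : ContDiff ℝ 2 ζ)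
    (hc : HasCompactSupport ζ) :
    ∫ x, gradDot ζ ζ x * gradDot u u x ≤
      ∫ x, (4 * (u x ^ 2 * hessSq ζ x) + 2 * (|u x| * |lap u x| * gradDot ζ ζ x)) := by
  have c1 := (hu.gradDot hu (m := 0) (by norm_num)).continuous
  have c3 := (hu.lap (m := 0) (by norm_num)).continuous
  have hk : ∀ k, ContDiff ℝ 1 (pd k ζ) := fun k => hζ.pd (by norm_num) k
  have ck : ∀ k, Continuous (gradDot (pd k ζ) (pd k ζ)) := fun k =>
    ((hk k).gradDot (hk k) (m := 0) (by norm_num)).continuous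
  have hs : ∀ k, HasCompactSupport (pd k ζ) := fun k => hc.pd k
  have e1 : ∀ x, gradDot ζ ζ x * gradDot u u x = ∑ k, pd k ζ x ^ 2 * gradDot u u x := fun x => by
    rw [show gradDot ζ ζ x = ∑ k, pd k ζ x ^ 2 by simp only [gradDot, sq], Finset.sum_mul]
  have e2 : ∀ x, 4 * (u x ^ 2 * hessSq ζ x) + 2 * (|u x| * |lap u x| * gradDot ζ ζ x)
      = ∑ k, (4 * (u x ^ 2 * gradDot (pd k ζ) (pd k ζ) x)
        + 2 * (|u x| * |lap u x| * pd k ζ x ^ 2)) := fun x => by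
    simp only [hessSq, gradDot, ← sq, Finset.mul_sum, Finset.sum_add_distrib]
  have i1 : ∀ k, Integrable fun x => pd k ζ x ^ 2 * gradDot u u x := fun k =>
    integrable_of_zero_off (((hk k).continuous.pow 2).mul c1) (hs k).isCompact fun x hx => by
      simp [zero_of_notMem hx]
  have i2 : ∀ k, Integrable fun x => 4 * (u x ^ 2 * gradDot (pd k ζ) (pd k ζ) x)
      + 2 * (|u x| * |lap u x| * pd k ζ x ^ 2) := fun k =>
    integrable_of_zero_off ((continuous_const.mul ((hu.continuous.pow 2).mul (ck k))).add
      (continuous_const.mul ((hu.continuous.abs.mul c3.abs).mul ((hk k).continuous.pow 2))))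
      (hs k).isCompact fun x hx => by simp [zero_of_notMem hx, gradDot_zero_of_notMem hx]
  simp only [e1, e2]
  rw [integral_finsetSum _ fun k _ => i1 k, integral_finsetSum _ fun k _ => i2 k]
  exact Finset.sum_le_sum fun k _ => integral_sq_mul_gradDot_le hu (hk k) (hs k)

end Interior

/-! ### The energy estimate on the support of a stable cutoff -/

section Energy

variable {N : ℕ} {u ζ F V : EuclideanSpace ℝ (Fin N) → ℝ} {p : ℝ}

theorem lap_mul_sq (hu : ContDiff ℝ 2 u) (hζ : ContDiff ℝ 2 ζ) (x) :
    lap (fun x => u x * ζ x ^ 2) x = ζ x ^ 2 * lap u x + 4 * (ζ x * gradDot ζ u x)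
      + u x * (2 * gradDot ζ ζ x + 2 * ζ x * lap ζ x) := by
  rw [lap_mul hu (hζ.pow 2), lap_pow_two hζ, gradDot_comm u]
  simp only [gradDot_pow_two (hζ.differentiable (by norm_num))]
  ring

/-- The terms in which `|Δ(uζ)|²` and `Δu Δ(uζ²)` differ contain only first derivatives of `u`,
apart from `u Δu |∇ζ|²`. -/
theorem lap_mul_sq_sub_le (hu : ContDiff ℝ 2 u) (hζ : ContDiff ℝ 2 ζ) (x) :
    lap (fun x => u x * ζ x) x ^ 2 - lap u x * lap (fun x => u x * ζ x ^ 2) x ≤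
      6 * (gradDot ζ ζ x * gradDot u u x) + 3 * (u x ^ 2 * lap ζ x ^ 2)
        + 2 * (|u x| * |lap u x| * gradDot ζ ζ x) := by
  rw [lap_mul_sq hu hζ, lap_mul hu hζ, gradDot_comm u ζ]
  have h1 := gradDot_sq_le ζ u x
  have h2 : 0 ≤ (|u x| * |lap u x| + u x * lap u x) * gradDot ζ ζ x := by
    refine mul_nonneg ?_ (gradDot_self_nonneg _ _)
    rw [← abs_mul]; linarith [neg_abs_le (u x * lap u x)]
  nlinarith [sq_nonneg (gradDot ζ u x - u x * lap ζ x)]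

theorem sq_mul_lap_sq_le (hu : ContDiff ℝ 2 u) (hζ : ContDiff ℝ 2 ζ) (x) :
    lap u x ^ 2 * ζ x ^ 2 - 2 * (lap u x * lap (fun x => u x * ζ x ^ 2) x) ≤
      32 * (gradDot ζ ζ x * gradDot u u x) + 8 * (u x ^ 2 * lap ζ x ^ 2)
        + 4 * (|u x| * |lap u x| * gradDot ζ ζ x) := by
  rw [lap_mul_sq hu hζ]
  have h1 := gradDot_sq_le ζ u x
  have h2 : 0 ≤ (|u x| * |lap u x| + u x * lap u x) * gradDot ζ ζ x := by
    refine mul_nonneg ?_ (gradDot_self_nonneg _ _)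
    rw [← abs_mul]; linarith [neg_abs_le (u x * lap u x)]
  nlinarith [sq_nonneg (ζ x * lap u x + 8 * gradDot ζ u x),
    sq_nonneg (ζ x * lap u x + 4 * (u x * lap ζ x))]

/-- If `uζ` satisfies the stability inequality, then `∫ (|Δu|² + F) ζ²` is bounded by `∫ u² V`,
where `F = |x|ᵃ uᵖ⁺¹` and `V` is a weight that dominates `|∇ζ|⁴ / ζ²` and `|D²ζ|²`. The constant
depends on `N` and `p` only. -/
theorem exists_energy_le (N : ℕ) (hp : 1 < p) :
    ∃ C : ℝ, 0 < C ∧ ∀ u ζ F V : EuclideanSpace ℝ (Fin N) → ℝ, ContDiff ℝ 4 u → ContDiff ℝ 4 ζ →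
      HasCompactSupport ζ → Continuous F → (∀ x, 0 ≤ F x) → Continuous V →
      (∀ x, x ∉ tsupport ζ → V x = 0) → (∀ x, gradDot ζ ζ x ^ 2 ≤ V x * ζ x ^ 2) →
      (∀ x, hessSq ζ x ≤ V x) →
      ∫ x, lap u x * lap (fun x => u x * ζ x ^ 2) x = ∫ x, F x * ζ x ^ 2 →
      p * ∫ x, F x * ζ x ^ 2 ≤ ∫ x, lap (fun x => u x * ζ x) x ^ 2 →
      ∫ x, (lap u x ^ 2 + F x) * ζ x ^ 2 ≤ C * ∫ x, u x ^ 2 * V x := by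
  set k : ℝ := (p - 1)⁻¹ with hk
  have hp0 : 0 < p - 1 := by linarith
  have hk0 : 0 < k := inv_pos.mpr hp0
  -- `K` is the total coefficient of `M = ∫ |u| |Δu| |∇ζ|²`, and `C₁` that of `U = ∫ u² V`, in the
  -- bound `b6` below
  set K : ℝ := 42 * k + 68 with hK
  set C₁ : ℝ := 3 * k * (24 + 3 * N) + 128 + 8 * N with hC₁
  refine ⟨2 * C₁ + K ^ 2, by positivity, ?_⟩
  intro u ζ F V hu hζ hc hF hF0 hV hVs hV1 hV2 heq hstab
  have hu2 := hu.of_le (m := 2) (by norm_num)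
  have hζ2 := hζ.of_le (m := 2) (by norm_num)
  have cu := hu.continuous
  have cζ := hζ.continuous
  have clu := (hu.lap (m := 0) (by norm_num)).continuous
  have cgu := (hu.gradDot hu (m := 0) (by norm_num)).continuous
  have cgζ := (hζ.gradDot hζ (m := 0) (by norm_num)).continuous
  have chζ := (hζ.hessSq (m := 0) (by norm_num)).continuous
  have cl1 := ((hu.mul hζ).lap (m := 0) (by norm_num)).continuous
  have cl2 := ((hu.mul (hζ.pow 2)).lap (m := 0) (by norm_num)).continuous
  have hcK := hc.isCompact
  have iG : Integrable fun x => gradDot ζ ζ x * gradDot u u x :=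
    integrable_of_zero_off (cgζ.mul cgu) hcK fun x hx => by simp [gradDot_zero_of_notMem hx]
  have iM : Integrable fun x => |u x| * |lap u x| * gradDot ζ ζ x :=
    integrable_of_zero_off ((cu.abs.mul clu.abs).mul cgζ) hcK fun x hx => by
      simp [gradDot_zero_of_notMem hx]
  have iU : Integrable fun x => u x ^ 2 * V x :=
    integrable_of_zero_off ((cu.pow 2).mul hV) hcK fun x hx => by simp [hVs x hx]
  have iS : Integrable fun x => lap u x ^ 2 * ζ x ^ 2 :=
    integrable_of_zero_off ((clu.pow 2).mul (cζ.pow 2)) hcK fun x hx => by simp [zero_of_notMem hx]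
  have iP : Integrable fun x => F x * ζ x ^ 2 :=
    integrable_of_zero_off (hF.mul (cζ.pow 2)) hcK fun x hx => by simp [zero_of_notMem hx]
  have iH : Integrable fun x => u x ^ 2 * hessSq ζ x :=
    integrable_of_zero_off ((cu.pow 2).mul chζ) hcK fun x hx => by simp [hessSq_zero_of_notMem hx]
  have hts1 : ∀ x, x ∉ tsupport ζ → x ∉ tsupport (fun x => u x * ζ x) := fun x hx h =>
    hx (tsupport_mul_subset_right h)
  have hts2 : ∀ x, x ∉ tsupport ζ → x ∉ tsupport (fun x => u x * ζ x ^ 2) := fun x hx h => by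
    refine hx (closure_mono ?_ h)
    intro y hy hy'
    exact hy (by simp [hy'])
  have i1 : Integrable fun x => lap (fun x => u x * ζ x) x ^ 2 :=
    integrable_of_zero_off (cl1.pow 2) hcK fun x hx => by simp [lap_zero_of_notMem (hts1 x hx)]
  have i2 : Integrable fun x => lap u x * lap (fun x => u x * ζ x ^ 2) x :=
    integrable_of_zero_off (clu.mul cl2) hcK fun x hx => by simp [lap_zero_of_notMem (hts2 x hx)]
  have hlap : ∀ x, u x ^ 2 * lap ζ x ^ 2 ≤ N * (u x ^ 2 * V x) := fun x => by
    have h1 := (lap_sq_le ζ x).trans (mul_le_mul_of_nonneg_left (hV2 x) (Nat.cast_nonneg N))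
    nlinarith [mul_le_mul_of_nonneg_left h1 (sq_nonneg (u x))]
  set S := ∫ x, lap u x ^ 2 * ζ x ^ 2 with hS
  set P := ∫ x, F x * ζ x ^ 2 with hP
  set G := ∫ x, gradDot ζ ζ x * gradDot u u x with hG
  set M := ∫ x, |u x| * |lap u x| * gradDot ζ ζ x with hM
  set U := ∫ x, u x ^ 2 * V x with hU
  have hS0 : 0 ≤ S := integral_nonneg fun x => by positivity
  have hP0 : 0 ≤ P := integral_nonneg fun x => mul_nonneg (hF0 x) (sq_nonneg _)
  have bG : G ≤ 4 * U + 2 * M := by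
    refine (integral_gradDot_mul_gradDot_le hu2 hζ2 hc).trans ?_
    rw [integral_add (iH.const_mul 4) (iM.const_mul 2), integral_const_mul, integral_const_mul]
    have : ∫ x, u x ^ 2 * hessSq ζ x ≤ U :=
      integral_mono iH iU fun x => mul_le_mul_of_nonneg_left (hV2 x) (sq_nonneg _)
    linarith
  have b1 : (p - 1) * P ≤ 6 * G + 3 * N * U + 2 * M := by
    have : ∫ x, (lap (fun x => u x * ζ x) x ^ 2 - lap u x * lap (fun x => u x * ζ x ^ 2) x) ≤
        ∫ x, (6 * (gradDot ζ ζ x * gradDot u u x) + 3 * N * (u x ^ 2 * V x)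
          + 2 * (|u x| * |lap u x| * gradDot ζ ζ x)) := by
      refine integral_mono (i1.sub i2) (integrable_lin_three iG iU iM _ _ _) fun x => ?_
      have := lap_mul_sq_sub_le hu2 hζ2 x
      have := hlap x
      dsimp only
      linarith
    rw [integral_sub i1 i2, integral_lin_three iG iU iM] at this
    linarith
  have b2 : S ≤ 2 * P + 32 * G + 8 * N * U + 4 * M := by
    have : ∫ x, (lap u x ^ 2 * ζ x ^ 2 - 2 * (lap u x * lap (fun x => u x * ζ x ^ 2) x)) ≤
        ∫ x, (32 * (gradDot ζ ζ x * gradDot u u x) + 8 * N * (u x ^ 2 * V x)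
          + 4 * (|u x| * |lap u x| * gradDot ζ ζ x)) := by
      refine integral_mono (iS.sub (i2.const_mul 2)) (integrable_lin_three iG iU iM _ _ _) fun x => ?_
      have := sq_mul_lap_sq_le hu2 hζ2 x
      have := hlap x
      dsimp only
      linarith
    rw [integral_sub iS (i2.const_mul 2), integral_const_mul, integral_lin_three iG iU iM] at this
    linarith
  have b3 : 2 * (K * M) ≤ S + K ^ 2 * U := by
    rw [← integral_const_mul, ← integral_const_mul, ← integral_const_mul,
      ← integral_add iS (iU.const_mul _)]
    refine integral_mono ((iM.const_mul _).const_mul _) (iS.add (iU.const_mul _)) fun x => ?_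
    have hV0 : 0 ≤ V x := (hessSq_nonneg ζ x).trans (hV2 x)
    refine two_mul_mul_le_of_sq_le (by positivity) (by positivity) ?_
    rw [mul_pow, mul_pow, sq_abs, sq_abs]
    have := mul_le_mul_of_nonneg_left (hV1 x) (mul_nonneg (sq_nonneg (u x)) (sq_nonneg (lap u x)))
    linarith
  have b4 : P ≤ k * (6 * G + 3 * N * U + 2 * M) := by
    have := mul_le_mul_of_nonneg_left b1 hk0.le
    rwa [← mul_assoc, hk, inv_mul_cancel₀ hp0.ne', one_mul, ← hk] at this
  have b5 : P ≤ k * ((24 + 3 * N) * U + 14 * M) :=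
    b4.trans (mul_le_mul_of_nonneg_left (by linarith) hk0.le)
  have e : ∫ x, (lap u x ^ 2 + F x) * ζ x ^ 2 = S + P := by
    rw [hS, hP, ← integral_add iS iP]; simp only [add_mul]
  rw [e]
  have b6 : S + P ≤ C₁ * U + K * M := by
    rw [hC₁, hK]; nlinarith
  linarith

end Energy

/-! ### Finite Morse index gives stability outside a ball -/

section MorseIndex

variable {N : ℕ} {a p : ℝ} {u φ ψ : EuclideanSpace ℝ (Fin N) → ℝ}

theorem continuous_norm_rpow_mul_rpow (ha : 0 ≤ a) (hu : Continuous u) (hpos : ∀ x, 0 < u x)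
    (q : ℝ) : Continuous fun x => ‖x‖ ^ a * u x ^ q :=
  (continuous_norm.rpow_const fun _ => Or.inr ha).mul
    (hu.rpow_const fun x => Or.inl (hpos x).ne')

/-- Functions vanishing, respectively, inside a ball and outside a smaller one contribute
separately to the second variation. -/
theorem henonSecondVariation_add_smul (ha : 0 ≤ a) (hu : Continuous u) (hpos : ∀ x, 0 < u x)
    (hφ : ContDiff ℝ 4 φ) (hψ : ContDiff ℝ 4 ψ) (hφc : HasCompactSupport φ)
    (hψc : HasCompactSupport ψ) {r s : ℝ} (hrs : r < s) (hφ0 : ∀ x, ‖x‖ < s → φ x = 0)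
    (hψ0 : ∀ x, r < ‖x‖ → ψ x = 0) (c : ℝ) :
    henonSecondVariation N a p u (ψ + c • φ) =
      henonSecondVariation N a p u ψ + c ^ 2 * henonSecondVariation N a p u φ := by
  have hφ2 := hφ.of_le (m := 2) (by norm_num)
  have hψ2 := hψ.of_le (m := 2) (by norm_num)
  have hloc : ∀ x, φ =ᶠ[𝓝 x] (fun _ => 0) ∨ ψ =ᶠ[𝓝 x] (fun _ => 0) := by
    intro x
    rcases lt_or_ge ‖x‖ s with h | h
    · left
      filter_upwards [(isOpen_lt continuous_norm continuous_const).mem_nhds h] with y hy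
        using hφ0 y hy
    · right
      filter_upwards [(isOpen_lt continuous_const continuous_norm).mem_nhds (hrs.trans_le h)]
        with y hy using hψ0 y hy
  have hlap0 : lap (fun _ : EuclideanSpace ℝ (Fin N) => (0 : ℝ)) = fun _ => 0 := by
    ext x; simp [lap]
  have hL : ∀ x, Δ (ψ + c • φ) x ^ 2 = Δ ψ x ^ 2 + c ^ 2 * Δ φ x ^ 2 := by
    intro x
    rw [(hψ2.contDiffAt).laplacian_add (f₂ := c • φ) (contDiff_const.smul hφ2).contDiffAt,
      InnerProductSpace.laplacian_smul c hφ2.contDiffAt, laplacian_eq_lap hφ2,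
      laplacian_eq_lap hψ2]
    rcases hloc x with h | h <;> rw [lap_congr h, hlap0] <;> simp [mul_pow]
  have hM : ∀ x, ‖x‖ ^ a * u x ^ (p - 1) * (ψ + c • φ) x ^ 2 =
      ‖x‖ ^ a * u x ^ (p - 1) * ψ x ^ 2 + c ^ 2 * (‖x‖ ^ a * u x ^ (p - 1) * φ x ^ 2) := by
    intro x
    rcases hloc x with h | h
    · simp [h.eq_of_nhds]
    · simp [h.eq_of_nhds, mul_pow]; ring
  have iL : ∀ {f : EuclideanSpace ℝ (Fin N) → ℝ}, ContDiff ℝ 4 f → HasCompactSupport f →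
      Integrable fun x => Δ f x ^ 2 := fun {f} hf hc => by
    rw [laplacian_eq_lap (hf.of_le (by norm_num))]
    exact integrable_of_zero_off ((hf.lap (m := 0) (by norm_num)).continuous.pow 2) hc.isCompact
      fun x hx => by simp [lap_zero_of_notMem hx]
  have iM : ∀ {f : EuclideanSpace ℝ (Fin N) → ℝ}, ContDiff ℝ 4 f → HasCompactSupport f →
      Integrable fun x => ‖x‖ ^ a * u x ^ (p - 1) * f x ^ 2 := fun {f} hf hc =>
    integrable_of_zero_off ((continuous_norm_rpow_mul_rpow ha hu hpos _).mul
      (hf.continuous.pow 2)) hc.isCompact fun x hx => by simp [zero_of_notMem hx]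
  simp only [henonSecondVariation, hL, hM]
  rw [integral_add (iL hψ hψc) ((iL hφ hφc).const_mul _),
    integral_add (iM hψ hψc) ((iM hφ hφc).const_mul _), integral_const_mul, integral_const_mul]
  ring

theorem henonSecondVariation_zero : henonSecondVariation N a p u 0 = 0 := by
  have : Δ (0 : EuclideanSpace ℝ (Fin N) → ℝ) = 0 := by
    rw [laplacian_eq_lap (f := (0 : EuclideanSpace ℝ (Fin N) → ℝ)) (contDiff_const (c := (0 : ℝ)))]
    ext x
    simp [lap_zero_of_notMem (f := (0 : EuclideanSpace ℝ (Fin N) → ℝ)) (x := x)]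
  simp [henonSecondVariation, this]

/-- A solution of finite Morse index is stable outside some ball: otherwise a maximal negative
space could be enlarged by a test function supported away from it. -/
theorem exists_stable_outside_ball (ha : 0 ≤ a) (hu : Continuous u) (hpos : ∀ x, 0 < u x)
    (h : HasFiniteHenonMorseIndex N a p u) :
    ∃ R : ℝ, 1 ≤ R ∧ ∀ φ : EuclideanSpace ℝ (Fin N) → ℝ, ContDiff ℝ 4 φ → HasCompactSupport φ →
      (∀ x, ‖x‖ < R → φ x = 0) → 0 ≤ henonSecondVariation N a p u φ := by
  obtain ⟨m, ⟨X, hfin, hX, hXm⟩, hmax⟩ := h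
  obtain ⟨s, hs⟩ : X.FG := Module.Finite.iff_fg.mp hfin
  have hsX : ∀ f ∈ s, f ∈ X := fun f hf => hs ▸ Submodule.subset_span hf
  have hK : IsCompact (⋃ f ∈ s, tsupport f) :=
    s.isCompact_biUnion fun f hf => (hX.hasCompactSupport f (hsX f hf)).isCompact
  obtain ⟨ρ, hρ⟩ := hK.isBounded.exists_norm_le
  have hXρ : ∀ ψ ∈ X, ∀ x, max ρ 0 < ‖x‖ → ψ x = 0 := by
    intro ψ hψ x hx
    rw [← hs] at hψ
    induction hψ using Submodule.span_induction with
    | mem f hf =>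
      refine zero_of_notMem fun h => absurd (hρ x (mem_biUnion hf h)) ?_
      exact not_le.mpr ((le_max_left _ _).trans_lt hx)
    | zero => rfl
    | add f g _ _ hf hg => simp [hf, hg]
    | smul c f _ hf => simp [hf]
  refine ⟨max ρ 0 + 1, by linarith [le_max_right ρ 0], fun φ hφ hφc hφ0 => ?_⟩
  by_contra! hneg
  have hφne : φ ≠ 0 := by
    rintro rfl
    simp [henonSecondVariation_zero] at hneg
  have hφX : φ ∉ X := fun hmem => hφne <| funext fun x => by
    rcases lt_or_ge ‖x‖ (max ρ 0 + 1) with h | h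
    · exact hφ0 x h
    · exact hXρ φ hmem x (by linarith)
  have hY : IsHenonNegativeSpace N a p u (X ⊔ Submodule.span ℝ {φ}) := by
    have hdec : ∀ y ∈ X ⊔ Submodule.span ℝ {φ}, ∃ ψ ∈ X, ∃ c : ℝ, ψ + c • φ = y := by
      intro y hy
      obtain ⟨ψ, hψ, z, hz, rfl⟩ := Submodule.mem_sup.mp hy
      obtain ⟨c, rfl⟩ := Submodule.mem_span_singleton.mp hz
      exact ⟨ψ, hψ, c, rfl⟩
    refine ⟨fun y hy => ?_, fun y hy => ?_, fun y hy hne => ?_⟩ <;>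
      obtain ⟨ψ, hψ, c, rfl⟩ := hdec y hy
    · exact (hX.contDiff ψ hψ).add (contDiff_const.smul hφ)
    · exact (hX.hasCompactSupport ψ hψ).add hφc.smul_left
    · rw [henonSecondVariation_add_smul ha hu hpos hφ (hX.contDiff ψ hψ) hφc
        (hX.hasCompactSupport ψ hψ) (lt_add_one (max ρ 0)) hφ0 (hXρ ψ hψ)]
      by_cases hψ0 : ψ = 0
      · have hc : c ≠ 0 := fun hc => hne (by simp [hψ0, hc])
        rw [hψ0, henonSecondVariation_zero, zero_add]
        exact mul_neg_of_pos_of_neg (by positivity) hneg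
      · have := hX.neg ψ hψ hψ0
        nlinarith [sq_nonneg c]
  have hdim : Module.finrank ℝ ↥(X ⊔ Submodule.span ℝ {φ}) = m + 1 := by
    have h1 := Submodule.finrank_sup_add_finrank_inf_eq X (Submodule.span ℝ {φ})
    have h2 : X ⊓ Submodule.span ℝ {φ} = ⊥ := by
      rw [← disjoint_iff]
      exact (Submodule.disjoint_span_singleton' hφne).mpr hφX
    rw [h2, finrank_bot, finrank_span_singleton hφne, hXm] at h1
    exact h1
  have := hmax ⟨_, inferInstance, hY, hdim⟩
  omega

end MorseIndex

/-! ### Cutoff functions -/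

section Cutoff

variable {N : ℕ} {f η : EuclideanSpace ℝ (Fin N) → ℝ} {R : ℝ}

/-- The dilation `x ↦ f (x / R)`. -/
noncomputable def dilate (R : ℝ) (f : EuclideanSpace ℝ (Fin N) → ℝ) :
    EuclideanSpace ℝ (Fin N) → ℝ :=
  fun x => f (R⁻¹ • x)

theorem ContDiff.dilate {n : WithTop ℕ∞} (hf : ContDiff ℝ n f) (R : ℝ) :
    ContDiff ℝ n (dilate R f) :=
  hf.comp (contDiff_id.const_smul R⁻¹)

theorem pd_dilate (hf : Differentiable ℝ f) (R : ℝ) (i : Fin N) :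
    pd i (dilate R f) = fun x => R⁻¹ * dilate R (pd i f) x := by
  ext x
  have h1 : HasFDerivAt (fun x : EuclideanSpace ℝ (Fin N) => R⁻¹ • x)
      (R⁻¹ • ContinuousLinearMap.id ℝ _) x := (hasFDerivAt_id x).const_smul R⁻¹
  have h2 := (hf (R⁻¹ • x)).hasFDerivAt.comp x h1
  change fderiv ℝ (f ∘ fun x => R⁻¹ • x) x _ = _
  rw [h2.fderiv]
  simp [dilate, pd]

theorem pd_pd_dilate (hf : ContDiff ℝ 2 f) (R : ℝ) (i j : Fin N) (x) :
    pd j (pd i (dilate R f)) x = R⁻¹ ^ 2 * pd j (pd i f) (R⁻¹ • x) := by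
  have h1 := hf.pd (m := 1) (by norm_num) i
  rw [pd_dilate (hf.differentiable (by norm_num)),
    pd_const_mul _ ((h1.dilate R).differentiable (by norm_num)),
    pd_dilate (h1.differentiable (by norm_num))]
  simp only [dilate]
  ring

theorem gradDot_dilate (hf : ContDiff ℝ 2 f) (R : ℝ) (x) :
    gradDot (dilate R f) (dilate R f) x = R⁻¹ ^ 2 * gradDot f f (R⁻¹ • x) := by
  simp only [gradDot, pd_dilate (hf.differentiable (by norm_num)), dilate, Finset.mul_sum]
  exact Finset.sum_congr rfl fun i _ => by ring

theorem lap_dilate (hf : ContDiff ℝ 2 f) (R : ℝ) (x) :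
    lap (dilate R f) x = R⁻¹ ^ 2 * lap f (R⁻¹ • x) := by
  simp only [lap, pd_pd_dilate hf, Finset.mul_sum]

theorem hessSq_dilate (hf : ContDiff ℝ 2 f) (R : ℝ) (x) :
    hessSq (dilate R f) x = R⁻¹ ^ 4 * hessSq f (R⁻¹ • x) := by
  simp only [hessSq, pd_pd_dilate hf, Finset.mul_sum]
  exact Finset.sum_congr rfl fun i _ => Finset.sum_congr rfl fun j _ => by ring

theorem norm_inv_smul (hR : 0 < R) (x : EuclideanSpace ℝ (Fin N)) : ‖R⁻¹ • x‖ = ‖x‖ / R := by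
  rw [norm_smul, norm_inv, Real.norm_of_nonneg hR.le]; ring

/-- `|∇η|⁴ + |D²η|²`, the weight in which the energy of a cutoff `η` is measured. -/
noncomputable def cutoffWeight (η : EuclideanSpace ℝ (Fin N) → ℝ) :
    EuclideanSpace ℝ (Fin N) → ℝ :=
  fun x => gradDot η η x ^ 2 + hessSq η x

theorem cutoffWeight_nonneg (η : EuclideanSpace ℝ (Fin N) → ℝ) (x) : 0 ≤ cutoffWeight η x :=
  add_nonneg (sq_nonneg _) (hessSq_nonneg _ _)

theorem continuous_cutoffWeight (hη : ContDiff ℝ 2 η) : Continuous (cutoffWeight η) :=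
  ((hη.gradDot hη (m := 0) (by norm_num)).continuous.pow 2).add
    (hη.hessSq (m := 0) (by norm_num)).continuous

theorem cutoffWeight_congr {x} (h : η =ᶠ[𝓝 x] f) : cutoffWeight η x = cutoffWeight f x := by
  simp only [cutoffWeight, gradDot_congr h h, hessSq_congr h]

theorem cutoffWeight_const (c : ℝ) (x) :
    cutoffWeight (fun _ : EuclideanSpace ℝ (Fin N) => c) x = 0 := by
  simp [cutoffWeight, gradDot, hessSq]

theorem cutoffWeight_dilate (hf : ContDiff ℝ 2 f) (R : ℝ) (x) :
    cutoffWeight (dilate R f) x = R⁻¹ ^ 4 * cutoffWeight f (R⁻¹ • x) := by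
  simp only [cutoffWeight, gradDot_dilate hf, hessSq_dilate hf]
  ring

theorem cutoffWeight_zero_of_notMem {x} (h : x ∉ tsupport η) : cutoffWeight η x = 0 := by
  simp [cutoffWeight, gradDot_zero_of_notMem h, hessSq_zero_of_notMem h]

theorem gradDot_pow_sq_le (hη : ContDiff ℝ 2 η) (n : ℕ) (x) :
    gradDot (fun x => η x ^ (n + 2)) (fun x => η x ^ (n + 2)) x ^ 2 ≤
      (2 * ((n : ℝ) + 2) ^ 4 * cutoffWeight η x * (η x ^ n) ^ 2) * (η x ^ (n + 2)) ^ 2 := by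
  have e : gradDot (fun x => η x ^ (n + 2)) (fun x => η x ^ (n + 2)) x =
      ((n : ℝ) + 2) ^ 2 * (η x ^ (n + 1)) ^ 2 * gradDot η η x := by
    simp only [gradDot, pd_pow (hη.differentiable (by norm_num)), Finset.mul_sum]
    refine Finset.sum_congr rfl fun i _ => ?_
    push_cast
    ring
  have h := hessSq_nonneg η x
  have h' : gradDot η η x ^ 2 ≤ 2 * cutoffWeight η x := by
    simp only [cutoffWeight]; nlinarith [sq_nonneg (gradDot η η x)]
  calc _ = ((n : ℝ) + 2) ^ 4 * (η x ^ (n + 1)) ^ 4 * gradDot η η x ^ 2 := by rw [e]; ring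
    _ ≤ ((n : ℝ) + 2) ^ 4 * (η x ^ (n + 1)) ^ 4 * (2 * cutoffWeight η x) := by gcongr
    _ = _ := by ring

theorem hessSq_pow_le (hη : ContDiff ℝ 2 η) {x} (h0 : 0 ≤ η x) (h1 : η x ≤ 1) (n : ℕ) :
    hessSq (fun x => η x ^ (n + 2)) x ≤
      2 * ((n : ℝ) + 2) ^ 4 * cutoffWeight η x * (η x ^ n) ^ 2 := by
  have dη := hη.differentiable (by norm_num)
  have e : ∀ i j, pd j (pd i fun x => η x ^ (n + 2)) x =
      (n + 2) * η x ^ n * (η x * pd j (pd i η) x + (n + 1) * (pd j η x * pd i η x)) := by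
    intro i j
    have d := (hη.pd (m := 1) (by norm_num) i).differentiable (by norm_num)
    rw [pd_pow dη, pd_mul ((differentiable_const _).fun_mul (dη.fun_pow _)) d,
      pd_const_mul _ (dη.fun_pow _), pd_pow dη]
    push_cast
    ring
  have hb : ∀ i j, pd j (pd i fun x => η x ^ (n + 2)) x ^ 2 ≤ 2 * ((n : ℝ) + 2) ^ 4 * (η x ^ n) ^ 2
      * (pd j (pd i η) x ^ 2 + (pd i η x * pd i η x) * (pd j η x * pd j η x)) := by
    intro i j
    have hη1 : η x ^ 2 ≤ 1 := pow_le_one₀ h0 h1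
    have i1 : (η x * pd j (pd i η) x + (n + 1) * (pd j η x * pd i η x)) ^ 2 ≤
        2 * ((n : ℝ) + 2) ^ 2 *
          (pd j (pd i η) x ^ 2 + (pd i η x * pd i η x) * (pd j η x * pd j η x)) := by
      set A := pd j (pd i η) x
      set B := pd j η x * pd i η x with hB
      have hB2 : (pd i η x * pd i η x) * (pd j η x * pd j η x) = B ^ 2 := by rw [hB]; ring
      have hn : (0 : ℝ) ≤ n := Nat.cast_nonneg n
      have k1 : η x ^ 2 * A ^ 2 ≤ ((n : ℝ) + 2) ^ 2 * A ^ 2 :=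
        mul_le_mul_of_nonneg_right (hη1.trans (by nlinarith)) (sq_nonneg _)
      have k2 : ((n : ℝ) + 1) ^ 2 * B ^ 2 ≤ ((n : ℝ) + 2) ^ 2 * B ^ 2 :=
        mul_le_mul_of_nonneg_right (by nlinarith) (sq_nonneg _)
      rw [hB2]
      nlinarith [sq_nonneg (η x * A - (n + 1) * B)]
    calc _ = ((n : ℝ) + 2) ^ 2 * (η x ^ n) ^ 2 *
          (η x * pd j (pd i η) x + (n + 1) * (pd j η x * pd i η x)) ^ 2 := by rw [e]; ring
      _ ≤ ((n : ℝ) + 2) ^ 2 * (η x ^ n) ^ 2 * (2 * ((n : ℝ) + 2) ^ 2 *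
          (pd j (pd i η) x ^ 2 + (pd i η x * pd i η x) * (pd j η x * pd j η x))) := by gcongr
      _ = _ := by ring
  calc hessSq (fun x => η x ^ (n + 2)) x
      ≤ ∑ i, ∑ j, 2 * ((n : ℝ) + 2) ^ 4 * (η x ^ n) ^ 2
        * (pd j (pd i η) x ^ 2 + (pd i η x * pd i η x) * (pd j η x * pd j η x)) :=
        Finset.sum_le_sum fun i _ => Finset.sum_le_sum fun j _ => hb i j
    _ = _ := by
      simp only [← Finset.mul_sum, Finset.sum_add_distrib, ← Finset.sum_mul, cutoffWeight,
        hessSq, gradDot]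
      ring

variable (N) in
/-- A smooth profile that is `1` on the unit ball and `0` outside the ball of radius `2`. -/
noncomputable def bump : ContDiffBump (0 : EuclideanSpace ℝ (Fin N)) := ⟨1, 2, one_pos, one_lt_two⟩

variable (N) in
/-- The standard cutoff, `1` on the ball of radius `R` and `0` outside the ball of
radius `2R`. -/
noncomputable def cutoff (R : ℝ) : EuclideanSpace ℝ (Fin N) → ℝ := dilate R (bump N)

theorem contDiff_cutoff {n : ℕ∞} (R : ℝ) : ContDiff ℝ n (cutoff N R) := (bump N).contDiff.dilate R

theorem cutoff_nonneg (R : ℝ) (x) : 0 ≤ cutoff N R x := (bump N).nonneg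

theorem cutoff_le_one (R : ℝ) (x) : cutoff N R x ≤ 1 := (bump N).le_one

theorem cutoff_eq_one (hR : 0 < R) {x : EuclideanSpace ℝ (Fin N)} (h : ‖x‖ ≤ R) :
    cutoff N R x = 1 := by
  refine (bump N).one_of_mem_closedBall ?_
  rw [mem_closedBall_zero_iff, norm_inv_smul hR]
  exact div_le_one_of_le₀ h hR.le

theorem cutoff_eq_zero (hR : 0 < R) {x : EuclideanSpace ℝ (Fin N)} (h : 2 * R ≤ ‖x‖) :
    cutoff N R x = 0 := by
  refine (bump N).zero_of_le_dist ?_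
  rw [dist_zero_right, norm_inv_smul hR]
  exact (le_div_iff₀ hR).mpr h

theorem cutoff_eventuallyEq_one (hR : 0 < R) {x : EuclideanSpace ℝ (Fin N)} (h : ‖x‖ < R) :
    cutoff N R =ᶠ[𝓝 x] fun _ => 1 := by
  filter_upwards [(isOpen_lt continuous_norm continuous_const).mem_nhds h] with y hy
    using cutoff_eq_one hR (le_of_lt hy)

theorem cutoff_eventuallyEq_zero (hR : 0 < R) {x : EuclideanSpace ℝ (Fin N)} (h : 2 * R < ‖x‖) :
    cutoff N R =ᶠ[𝓝 x] fun _ => 0 := by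
  filter_upwards [(isOpen_lt continuous_const continuous_norm).mem_nhds h] with y hy
    using cutoff_eq_zero hR (le_of_lt hy)

theorem hasCompactSupport_cutoff (hR : 0 < R) : HasCompactSupport (cutoff N R) :=
  HasCompactSupport.intro (isCompact_closedBall 0 (2 * R)) fun x hx => by
    rw [mem_closedBall_zero_iff, not_le] at hx
    exact cutoff_eq_zero hR hx.le

theorem exists_cutoffWeight_le (hf : ContDiff ℝ 2 f) (hc : HasCompactSupport f) :
    ∃ B, 0 ≤ B ∧ ∀ R x, cutoffWeight (dilate R f) x ≤ B * R⁻¹ ^ 4 := by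
  have hW : HasCompactSupport (cutoffWeight f) :=
    HasCompactSupport.intro hc.isCompact fun x hx => cutoffWeight_zero_of_notMem hx
  obtain ⟨B, hB⟩ := (continuous_cutoffWeight hf).bounded_above_of_compact_support hW
  refine ⟨B, (norm_nonneg _).trans (hB 0), fun R x => ?_⟩
  rw [cutoffWeight_dilate hf, mul_comm]
  refine mul_le_mul_of_nonneg_right ((le_abs_self _).trans (hB _)) (by positivity)

end Cutoff

/-! ### Young's inequality for the weighted power -/

/-- `t² w` is absorbed into `y tᵖ⁺¹` at the price of a power of `w`; a high power `z ^ n` of a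
cutoff leaves enough room for the factor `(z ^ (n + 2))²`: `4 ≤ n (p - 1)` means that
`2 (n + 2) ≤ n (p + 1)`. -/
theorem exists_young {p : ℝ} (hp : 1 < p) {n : ℕ} (hn : 4 ≤ n * (p - 1)) (C : ℝ) (hC : 0 < C) :
    ∃ C' : ℝ, 0 < C' ∧ ∀ t w y z : ℝ, 0 ≤ t → 0 ≤ w → 0 < y → 0 ≤ z → z ≤ 1 →
      C * (t ^ 2 * (w * (z ^ n) ^ 2)) ≤ 1 / 2 * (y * t ^ (p + 1) * (z ^ (n + 2)) ^ 2)
        + C' * (w ^ ((p + 1) / (p - 1)) * y ^ (-(2 / (p - 1)))) := by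
  have hp0 : 0 < p - 1 := by linarith
  have hp1 : 0 < p + 1 := by linarith
  set r := (p + 1) / 2 with hr
  set s := (p + 1) / (p - 1) with hs
  have hr1 : 1 ≤ r := by rw [hr]; linarith
  have hs1 : 1 ≤ s := by rw [hs, le_div_iff₀ hp0]; linarith
  have hrs : r.HolderConjugate s := by
    rw [Real.holderConjugate_iff]
    refine ⟨by rw [hr]; linarith, ?_⟩
    rw [hr, hs]; field_simp; ring
  refine ⟨(2 * C) ^ s, by positivity, fun t w y z ht hw hy hz hz1 => ?_⟩
  set A := 1 / 2 * t ^ 2 * y ^ (2 / (p + 1)) * (z ^ n) ^ 2 with hA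
  set B := 2 * C * w * y ^ (-(2 / (p + 1))) with hB
  have hA0 : 0 ≤ A := by positivity
  have hB0 : 0 ≤ B := by positivity
  have hAB : A * B = C * (t ^ 2 * (w * (z ^ n) ^ 2)) := by
    have : y ^ (2 / (p + 1)) * y ^ (-(2 / (p + 1))) = 1 := by
      rw [← Real.rpow_add hy, add_neg_cancel, Real.rpow_zero]
    rw [hA, hB]
    linear_combination C * t ^ 2 * w * (z ^ n) ^ 2 * this
  have hAr : A ^ r ≤ 1 / 2 * (y * t ^ (p + 1) * (z ^ (n + 2)) ^ 2) := by
    rw [hA, Real.mul_rpow (by positivity) (by positivity),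
      Real.mul_rpow (by positivity) (by positivity), Real.mul_rpow (by norm_num) (by positivity),
      ← Real.rpow_mul hy.le]
    have e1 : (2 / (p + 1)) * r = 1 := by rw [hr]; field_simp
    have e2 : (t ^ 2) ^ r = t ^ (p + 1) := by
      rw [← Real.rpow_natCast, ← Real.rpow_mul ht]; congr 1; rw [hr]; push_cast; ring
    have e3 : ((z ^ n) ^ 2) ^ r ≤ (z ^ (n + 2)) ^ 2 := by
      rw [← pow_mul, ← pow_mul, ← Real.rpow_natCast, ← Real.rpow_natCast, ← Real.rpow_mul hz]
      refine Real.rpow_le_rpow_of_exponent_ge' hz hz1 (by positivity) ?_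
      rw [hr]; push_cast; nlinarith
    have e4 : (1 / 2 : ℝ) ^ r ≤ 1 / 2 := by
      simpa using Real.rpow_le_rpow_of_exponent_ge (x := (1 / 2 : ℝ)) (by norm_num) (by norm_num) hr1
    rw [e1, e2, Real.rpow_one]
    calc (1 / 2 : ℝ) ^ r * t ^ (p + 1) * y * ((z ^ n) ^ 2) ^ r
        ≤ 1 / 2 * t ^ (p + 1) * y * (z ^ (n + 2)) ^ 2 := by gcongr
      _ = _ := by ring
  have hBs : B ^ s = (2 * C) ^ s * (w ^ s * y ^ (-(2 / (p - 1)))) := by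
    rw [hB, Real.mul_rpow (by positivity) (by positivity),
      Real.mul_rpow (by positivity) hw, ← Real.rpow_mul hy.le]
    have : -(2 / (p + 1)) * s = -(2 / (p - 1)) := by rw [hs]; field_simp
    rw [this]; ring
  have hy1 := Real.young_inequality_of_nonneg hA0 hB0 hrs
  rw [hAB] at hy1
  have k1 : A ^ r / r ≤ A ^ r := div_le_self (by positivity) hr1
  have k2 : B ^ s / s ≤ B ^ s := div_le_self (by positivity) hs1
  linarith

/-! ### Finiteness of the energy -/

section FiniteEnergy

variable {N : ℕ} {a p : ℝ} {u : EuclideanSpace ℝ (Fin N) → ℝ}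

/-- The density `|x|ᵃ uᵖ⁺¹` of the potential energy. -/
noncomputable def potentialDensity (a p : ℝ) (u : EuclideanSpace ℝ (Fin N) → ℝ) :
    EuclideanSpace ℝ (Fin N) → ℝ :=
  fun x => ‖x‖ ^ a * u x ^ (p + 1)

/-- The exponent `κ` for which Young's inequality leaves the remainder `ρ ^ (-κ)` on the annulus of
radius `ρ`. -/
noncomputable def decayExponent (a p : ℝ) : ℝ := (4 * (p + 1) + 2 * a) / (p - 1)

theorem lt_decayExponent (hN : 5 ≤ N) (hp : 1 < p)
    (hpN : p < ((N : ℝ) + 4 + 2 * a) / ((N : ℝ) - 4)) : (N : ℝ) < decayExponent a p := by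
  have hN' : (5 : ℝ) ≤ N := by exact_mod_cast hN
  rw [lt_div_iff₀ (by linarith)] at hpN
  rw [decayExponent, lt_div_iff₀ (by linarith)]
  linarith

theorem rpow_mul_rpow_le (ha : 0 ≤ a) (hp : 1 < p) {w B ρ : ℝ} (hw : 0 ≤ w) (hB : 0 ≤ B)
    (hρ : 0 < ρ) (hwB : w ≤ B * ρ⁻¹ ^ 4) {x : EuclideanSpace ℝ (Fin N)} (hx : ρ ≤ ‖x‖) :
    w ^ ((p + 1) / (p - 1)) * (‖x‖ ^ a) ^ (-(2 / (p - 1))) ≤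
      B ^ ((p + 1) / (p - 1)) * ρ ^ (-decayExponent a p) := by
  have hp0 : 0 < p - 1 := by linarith
  have h1 : w ^ ((p + 1) / (p - 1)) ≤ B ^ ((p + 1) / (p - 1)) * ρ ^ (-4 * ((p + 1) / (p - 1))) := by
    refine (Real.rpow_le_rpow hw hwB (by positivity)).trans_eq ?_
    rw [Real.mul_rpow hB (by positivity), Real.rpow_mul hρ.le]
    congr 2
    rw [Real.rpow_neg hρ.le, inv_pow]
    norm_cast
  have h2 : (‖x‖ ^ a) ^ (-(2 / (p - 1))) ≤ ρ ^ (a * -(2 / (p - 1))) := by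
    rw [Real.rpow_mul hρ.le]
    refine Real.rpow_le_rpow_of_nonpos (by positivity) (Real.rpow_le_rpow hρ.le hx ha) ?_
    have : 0 ≤ 2 / (p - 1) := by positivity
    linarith
  calc _ ≤ B ^ ((p + 1) / (p - 1)) * ρ ^ (-4 * ((p + 1) / (p - 1))) * ρ ^ (a * -(2 / (p - 1))) :=
        mul_le_mul h1 h2 (by positivity) (by positivity)
    _ = _ := by
      rw [mul_assoc, ← Real.rpow_add hρ]
      congr 2
      rw [decayExponent]; field_simp; ring

/-- `∫ ρ ^ (-κ)` over the ball of radius `cρ` is of the order `ρ ^ (N - κ)`. -/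
theorem integral_indicator_closedBall {ρ c : ℝ} (hρ : 0 < ρ) (hc : 0 ≤ c) (κ : ℝ) :
    ∫ x, (Metric.closedBall (0 : EuclideanSpace ℝ (Fin N)) (c * ρ)).indicator
        (fun _ => ρ ^ (-κ)) x =
      c ^ N * volume.real (Metric.ball (0 : EuclideanSpace ℝ (Fin N)) 1) * ρ ^ ((N : ℝ) - κ) := by
  rw [integral_indicator Metric.isClosed_closedBall.measurableSet, setIntegral_const,
    Measure.addHaar_real_closedBall _ _ (by positivity), finrank_euclideanSpace_fin, smul_eq_mul,
    sub_eq_add_neg, Real.rpow_add hρ, Real.rpow_natCast]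
  ring

theorem integrable_indicator_closedBall (r b : ℝ) :
    Integrable ((Metric.closedBall (0 : EuclideanSpace ℝ (Fin N)) r).indicator fun _ => b) :=
  (integrable_indicator_iff Metric.isClosed_closedBall.measurableSet).mpr
    (integrableOn_const (isCompact_closedBall _ _).measure_lt_top.ne)

theorem cutoffWeight_one_sub {f : EuclideanSpace ℝ (Fin N) → ℝ} (hf : ContDiff ℝ 2 f) (x) :
    cutoffWeight (fun x => 1 - f x) x = cutoffWeight f x := by
  have h : ∀ i, pd i (fun x => 1 - f x) = fun x => 0 - pd i f x := fun i => by
    rw [pd_sub (differentiable_const _) (hf.differentiable (by norm_num)), pd_const]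
  have h2 : ∀ i j, pd j (fun x => 0 - pd i f x) = fun x => 0 - pd j (pd i f) x := fun i j => by
    rw [pd_sub (differentiable_const _)
      ((hf.pd (m := 1) (by norm_num) i).differentiable (by norm_num)), pd_const]
  simp only [cutoffWeight, gradDot, hessSq, h, h2]
  simp

theorem cutoffWeight_cutoff_eq_zero {ρ : ℝ} (hρ : 0 < ρ) {x : EuclideanSpace ℝ (Fin N)}
    (hx : ‖x‖ < ρ ∨ 2 * ρ < ‖x‖) : cutoffWeight (cutoff N ρ) x = 0 := by
  rcases hx with h | h
  · rw [cutoffWeight_congr (cutoff_eventuallyEq_one hρ h), cutoffWeight_const]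
  · rw [cutoffWeight_congr (cutoff_eventuallyEq_zero hρ h), cutoffWeight_const]

namespace IsPositiveHenonSolution

theorem lap_lap (hu : IsPositiveHenonSolution N a p u) (x) :
    lap (lap u) x = ‖x‖ ^ a * u x ^ p := by
  rw [← hu.eqn x, laplacian_eq_lap (hu.contDiff.of_le (by norm_num)),
    laplacian_eq_lap (hu.contDiff.lap (by norm_num))]

theorem density_eq (hu : IsPositiveHenonSolution N a p u) (x) :
    potentialDensity a p u x = ‖x‖ ^ a * u x ^ p * u x := by
  rw [potentialDensity, Real.rpow_add_one (hu.pos x).ne', mul_assoc]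

theorem continuous_density (hu : IsPositiveHenonSolution N a p u) (ha : 0 ≤ a) :
    Continuous (potentialDensity a p u) :=
  continuous_norm_rpow_mul_rpow ha hu.contDiff.continuous hu.pos _

theorem density_nonneg (hu : IsPositiveHenonSolution N a p u) (x) : 0 ≤ potentialDensity a p u x :=
  mul_nonneg (by positivity) (Real.rpow_nonneg (hu.pos x).le _)

/-- The equation tested against `u ζ²`. -/
theorem integral_lap_mul_lap_sq (hu : IsPositiveHenonSolution N a p u)
    {ζ : EuclideanSpace ℝ (Fin N) → ℝ} (hζ : ContDiff ℝ 4 ζ) (hc : HasCompactSupport ζ) :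
    ∫ x, lap u x * lap (fun x => u x * ζ x ^ 2) x = ∫ x, potentialDensity a p u x * ζ x ^ 2 := by
  have hg : ContDiff ℝ 4 fun x => u x * ζ x ^ 2 := hu.contDiff.mul (hζ.pow 2)
  rw [← integral_lap_mul (hu.contDiff.lap (by norm_num)) (hg.of_le (by norm_num))
    (HasCompactSupport.intro hc.isCompact fun x hx => by simp [zero_of_notMem hx])]
  congr 1 with x
  rw [hu.lap_lap, hu.density_eq]; ring

/-- Stability tested with `u ζ`. -/
theorem le_integral_lap_sq (hu : IsPositiveHenonSolution N a p u)
    {ζ : EuclideanSpace ℝ (Fin N) → ℝ} (hζ : ContDiff ℝ 4 ζ)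
    (hst : 0 ≤ henonSecondVariation N a p u fun x => u x * ζ x) :
    p * ∫ x, potentialDensity a p u x * ζ x ^ 2 ≤ ∫ x, lap (fun x => u x * ζ x) x ^ 2 := by
  have hg : ContDiff ℝ 4 fun x => u x * ζ x := hu.contDiff.mul hζ
  rw [henonSecondVariation, laplacian_eq_lap (hg.of_le (by norm_num)), sub_nonneg] at hst
  have e : ∀ x, ‖x‖ ^ a * u x ^ (p - 1) * (u x * ζ x) ^ 2 = potentialDensity a p u x * ζ x ^ 2 := by
    intro x
    rw [potentialDensity, show p + 1 = (p - 1) + (2 : ℕ) by push_cast; ring,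
      Real.rpow_add_natCast (hu.pos x).ne']
    ring
  simpa only [e] using hst

/-- A solution that is stable outside a ball has finite energy, `|Δu|² + |x|ᵃ uᵖ⁺¹ ∈ L¹`. The
exponent `κ` of the remainder exceeds `N` exactly in the subcritical range. -/
theorem integrable_energy (hu : IsPositiveHenonSolution N a p u) (ha : 0 ≤ a) (hp : 1 < p)
    (hκ : (N : ℝ) < decayExponent a p) {R₀ : ℝ} (hR₀ : 1 ≤ R₀)
    (hst : ∀ φ : EuclideanSpace ℝ (Fin N) → ℝ, ContDiff ℝ 4 φ → HasCompactSupport φ →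
      (∀ x, ‖x‖ < R₀ → φ x = 0) → 0 ≤ henonSecondVariation N a p u φ) :
    Integrable fun x => lap u x ^ 2 + potentialDensity a p u x := by
  have hp0 : 0 < p - 1 := by linarith
  have hR₀' : 0 < R₀ := by linarith
  have hs0 : (p + 1) / (p - 1) ≠ 0 := by positivity
  obtain ⟨n, hn⟩ := exists_nat_ge (4 / (p - 1))
  rw [div_le_iff₀ hp0] at hn
  obtain ⟨C, hC, hE⟩ := exists_energy_le N hp
  set c : ℝ := 2 * ((n : ℝ) + 2) ^ 4 with hc
  obtain ⟨C', hC', hY⟩ := exists_young hp hn (C * c) (by positivity)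
  obtain ⟨B, hB, hWB⟩ := exists_cutoffWeight_le (f := bump N) (bump N).contDiff
    (bump N).hasCompactSupport
  set F := potentialDensity a p u with hF
  have hFc : Continuous F := hu.continuous_density ha
  have hF0 := hu.density_nonneg
  have hlc : Continuous (lap u) := (hu.contDiff.lap (m := 0) (by norm_num)).continuous
  set D : ℝ := C' * B ^ ((p + 1) / (p - 1)) with hD
  have hD0 : 0 ≤ D := by positivity
  set v := volume.real (Metric.ball (0 : EuclideanSpace ℝ (Fin N)) 1) with hv
  have hv0 : 0 ≤ v := measureReal_nonneg
  let J : ℝ → EuclideanSpace ℝ (Fin N) → ℝ := fun ρ =>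
    (Metric.closedBall 0 (2 * ρ)).indicator fun _ => ρ ^ (-decayExponent a p)
  have hJ0 : ∀ ρ, 0 < ρ → ∀ x, 0 ≤ J ρ x := fun ρ hρ x =>
    indicator_nonneg (fun _ _ => by positivity) x
  have hJ : ∀ ρ, 1 ≤ ρ → ∫ x, J ρ x ≤ 2 ^ N * v := fun ρ hρ => by
    have h := integral_indicator_closedBall (N := N) (ρ := ρ) (c := 2) (by linarith) (by norm_num)
      (decayExponent a p)
    refine h.trans_le (mul_le_of_le_one_right (by positivity) ?_)
    exact Real.rpow_le_one_of_one_le_of_nonpos hρ (by linarith)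
  have hWJ : ∀ ρ, 0 < ρ → ∀ x, C' * (cutoffWeight (cutoff N ρ) x ^ ((p + 1) / (p - 1))
      * (‖x‖ ^ a) ^ (-(2 / (p - 1)))) ≤ D * J ρ x := by
    intro ρ hρ x
    by_cases hx : ‖x‖ < ρ ∨ 2 * ρ < ‖x‖
    · rw [cutoffWeight_cutoff_eq_zero hρ hx, Real.zero_rpow hs0, zero_mul, mul_zero]
      exact mul_nonneg hD0 (hJ0 ρ hρ x)
    · push Not at hx
      have : J ρ x = ρ ^ (-decayExponent a p) :=
        indicator_of_mem (mem_closedBall_zero_iff.mpr hx.2) _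
      rw [this, hD, mul_assoc]
      exact mul_le_mul_of_nonneg_left (rpow_mul_rpow_le ha hp (cutoffWeight_nonneg _ _) hB hρ
        (hWB ρ x) hx.1) hC'.le
  -- the cutoff vanishes on the ball of radius `R₀`, where stability is not available
  have key : ∀ R, 2 * R₀ < R → ∫ x in Metric.closedBall 0 R, (lap u x ^ 2 + F x) ≤
      (∫ x in Metric.closedBall 0 (2 * R₀), (lap u x ^ 2 + F x)) + 4 * D * (2 ^ N * v) := by
    intro R hR
    have hR' : 0 < R := by linarith
    set η : EuclideanSpace ℝ (Fin N) → ℝ := fun x => (1 - cutoff N R₀ x) * cutoff N R x with hη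
    have hη4 : ContDiff ℝ 4 η := (contDiff_const.sub (contDiff_cutoff (n := 4) R₀)).mul
      (contDiff_cutoff (n := 4) R)
    have hη2 : ContDiff ℝ 2 η := hη4.of_le (by norm_num)
    have hη0 : ∀ x, 0 ≤ η x := fun x =>
      mul_nonneg (sub_nonneg.mpr (cutoff_le_one _ _)) (cutoff_nonneg _ _)
    have hη1 : ∀ x, η x ≤ 1 := fun x =>
      mul_le_one₀ (by linarith [cutoff_nonneg R₀ x]) (cutoff_nonneg _ _) (cutoff_le_one _ _)
    have hηc : HasCompactSupport η := (hasCompactSupport_cutoff hR').mul_left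
    have hW : ∀ x, cutoffWeight η x = cutoffWeight (cutoff N R₀) x ∨
        cutoffWeight η x = cutoffWeight (cutoff N R) x := by
      intro x
      rcases lt_or_ge ‖x‖ R with h | h
      · left
        rw [← cutoffWeight_one_sub (contDiff_cutoff (n := 2) R₀)]
        apply cutoffWeight_congr
        filter_upwards [cutoff_eventuallyEq_one hR' h] with y hy
        simp [hη, hy]
      · right
        apply cutoffWeight_congr
        filter_upwards [cutoff_eventuallyEq_zero hR₀' (x := x) (by linarith)] with y hy
        simp [hη, hy]
    have hWz : ∀ x, ‖x‖ < R₀ → cutoffWeight η x = 0 := fun x hx => by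
      rcases hW x with h | h <;> rw [h]
      · exact cutoffWeight_cutoff_eq_zero hR₀' (Or.inl hx)
      · exact cutoffWeight_cutoff_eq_zero hR' (Or.inl (by linarith))
    set ζ : EuclideanSpace ℝ (Fin N) → ℝ := fun x => η x ^ (n + 2) with hζ
    have hζ4 : ContDiff ℝ 4 ζ := hη4.pow _
    have hζs : tsupport ζ = tsupport η := by
      have : Function.support ζ = Function.support η := by ext y; simp [hζ]
      rw [tsupport, this, tsupport]
    have hζc : HasCompactSupport ζ := by rw [HasCompactSupport, hζs]; exact hηc
    have iF : Integrable fun x => F x * ζ x ^ 2 := integrable_of_zero_off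
      (hFc.mul (hζ4.continuous.pow 2)) hζc.isCompact fun x hx => by simp [zero_of_notMem hx]
    have iS : Integrable fun x => (lap u x ^ 2 + F x) * ζ x ^ 2 := integrable_of_zero_off
      (((hlc.pow 2).add hFc).mul (hζ4.continuous.pow 2)) hζc.isCompact fun x hx => by
        simp [zero_of_notMem hx]
    have hVc : Continuous fun x => c * cutoffWeight η x * (η x ^ n) ^ 2 :=
      (continuous_const.mul (continuous_cutoffWeight hη2)).mul ((hη4.continuous.pow n).pow 2)
    have hVs : ∀ x, x ∉ tsupport ζ → c * cutoffWeight η x * (η x ^ n) ^ 2 = 0 := fun x hx => by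
      rw [hζs] at hx; simp [cutoffWeight_zero_of_notMem hx]
    have h1 := hE u ζ F (fun x => c * cutoffWeight η x * (η x ^ n) ^ 2) hu.contDiff hζ4 hζc hFc hF0
      hVc hVs (gradDot_pow_sq_le hη2 n) (fun x => hessSq_pow_le hη2 (hη0 x) (hη1 x) n)
      (hu.integral_lap_mul_lap_sq hζ4 hζc)
      (hu.le_integral_lap_sq hζ4 (hst _ (hu.contDiff.mul hζ4) hζc.mul_left fun x hx => by
        simp [hζ, hη, cutoff_eq_one hR₀' hx.le]))
    have hpt : ∀ x, C * (u x ^ 2 * (c * cutoffWeight η x * (η x ^ n) ^ 2)) ≤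
        1 / 2 * (F x * ζ x ^ 2) + D * J R₀ x + D * J R x := by
      intro x
      have hj0 := mul_nonneg hD0 (hJ0 R₀ hR₀' x)
      have hj1 := mul_nonneg hD0 (hJ0 R hR' x)
      have hFz : 0 ≤ F x * ζ x ^ 2 := mul_nonneg (hF0 x) (sq_nonneg _)
      rcases lt_or_ge ‖x‖ R₀ with h | h
      · rw [hWz x h]; simp only [mul_zero, zero_mul]; linarith
      · have hx : 0 < ‖x‖ ^ a := Real.rpow_pos_of_pos (by linarith) _
        have h2 := hY (u x) (cutoffWeight η x) (‖x‖ ^ a) (η x) (hu.pos x).le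
          (cutoffWeight_nonneg _ _) hx (hη0 x) (hη1 x)
        have h3 : C' * (cutoffWeight η x ^ ((p + 1) / (p - 1))
            * (‖x‖ ^ a) ^ (-(2 / (p - 1)))) ≤ D * J R₀ x + D * J R x := by
          rcases hW x with h | h <;> rw [h]
          · linarith [hWJ R₀ hR₀' x]
          · linarith [hWJ R hR' x]
        have e : C * (u x ^ 2 * (c * cutoffWeight η x * (η x ^ n) ^ 2)) =
          C * c * (u x ^ 2 * (cutoffWeight η x * (η x ^ n) ^ 2)) := by ring
        rw [e]
        refine h2.trans ?_
        simp only [hF, potentialDensity, hζ]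
        linarith
    have iV : Integrable fun x => u x ^ 2 * (c * cutoffWeight η x * (η x ^ n) ^ 2) :=
      integrable_of_zero_off ((hu.contDiff.continuous.pow 2).mul hVc) hζc.isCompact fun x hx => by
        rw [hVs x hx, mul_zero]
    have iJ : ∀ ρ, Integrable (J ρ) := fun ρ => integrable_indicator_closedBall _ _
    have h2 : C * ∫ x, u x ^ 2 * (c * cutoffWeight η x * (η x ^ n) ^ 2) ≤
        1 / 2 * (∫ x, F x * ζ x ^ 2) + D * (∫ x, J R₀ x) + D * ∫ x, J R x := by
      rw [← integral_const_mul, ← integral_lin_three iF (iJ R₀) (iJ R)]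
      exact integral_mono (iV.const_mul C) (integrable_lin_three iF (iJ R₀) (iJ R) _ _ _) hpt
    have h3 : ∫ x, F x * ζ x ^ 2 ≤ ∫ x, (lap u x ^ 2 + F x) * ζ x ^ 2 :=
      integral_mono iF iS fun x => by
        dsimp only; nlinarith [mul_nonneg (sq_nonneg (lap u x)) (sq_nonneg (ζ x))]
    have h4 : ∫ x, (lap u x ^ 2 + F x) * ζ x ^ 2 ≤ 4 * D * (2 ^ N * v) := by
      have k1 := mul_le_mul_of_nonneg_left (hJ R₀ hR₀) hD0
      have k2 := mul_le_mul_of_nonneg_left (hJ R (by linarith)) hD0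
      linarith
    have hgc : Continuous fun x => lap u x ^ 2 + F x := (hlc.pow 2).add hFc
    have ig : ∀ r, Integrable ((Metric.closedBall (0 : EuclideanSpace ℝ (Fin N)) r).indicator
        fun x => lap u x ^ 2 + F x) := fun r =>
      (integrable_indicator_iff Metric.isClosed_closedBall.measurableSet).mpr
        (hgc.continuousOn.integrableOn_compact (isCompact_closedBall _ _))
    rw [← integral_indicator Metric.isClosed_closedBall.measurableSet,
      ← integral_indicator Metric.isClosed_closedBall.measurableSet]
    refine le_trans ?_ (add_le_add_right h4 _)
    rw [← integral_add (ig _) iS]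
    refine integral_mono (ig _) ((ig _).add iS) fun x => ?_
    have hg0 : 0 ≤ lap u x ^ 2 + F x := add_nonneg (sq_nonneg _) (hF0 x)
    have hi0 : ∀ r, 0 ≤ (Metric.closedBall (0 : EuclideanSpace ℝ (Fin N)) r).indicator
        (fun x => lap u x ^ 2 + F x) x := fun r =>
      indicator_apply_nonneg fun _ => hg0
    dsimp only
    rcases le_or_gt ‖x‖ R with hxR | hxR
    · rcases le_or_gt ‖x‖ (2 * R₀) with hx0 | hx0
      · rw [indicator_of_mem (mem_closedBall_zero_iff.mpr hxR),
          indicator_of_mem (mem_closedBall_zero_iff.mpr hx0)]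
        have := mul_nonneg hg0 (sq_nonneg (ζ x))
        linarith
      · have hζ1 : ζ x = 1 := by
          simp [hζ, hη, cutoff_eq_one hR' hxR, cutoff_eq_zero hR₀' hx0.le]
        rw [indicator_of_mem (mem_closedBall_zero_iff.mpr hxR), hζ1]
        have := hi0 (2 * R₀)
        linarith
    · rw [indicator_of_notMem (fun h => absurd (mem_closedBall_zero_iff.mp h) (not_le.mpr hxR))]
      have := mul_nonneg hg0 (sq_nonneg (ζ x))
      have := hi0 (2 * R₀)
      linarith
  refine (aecover_closedBall (x := (0 : EuclideanSpace ℝ (Fin N)))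
    tendsto_id).integrable_of_integral_bounded_of_nonneg_ae _ (fun R => ?_)
    (Eventually.of_forall fun x => add_nonneg (sq_nonneg _) (hF0 x))
    ((eventually_gt_atTop (2 * R₀)).mono key)
  exact ((hlc.pow 2).add hFc).continuousOn.integrableOn_compact (isCompact_closedBall _ _)

end IsPositiveHenonSolution

end FiniteEnergy

/-! ### Decay on large annuli -/

section Annulus

variable {N : ℕ} {a p : ℝ} {u : EuclideanSpace ℝ (Fin N) → ℝ}

theorem tendsto_integral_tail {g : EuclideanSpace ℝ (Fin N) → ℝ} (hg : Integrable g) :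
    Tendsto (fun R : ℝ => ∫ x, {x | R / 4 ≤ ‖x‖}.indicator g x) atTop (𝓝 0) := by
  have hm : ∀ R : ℝ, MeasurableSet {x : EuclideanSpace ℝ (Fin N) | R / 4 ≤ ‖x‖} := fun R =>
    (isClosed_le continuous_const continuous_norm).measurableSet
  rw [← integral_zero (EuclideanSpace ℝ (Fin N)) ℝ]
  refine tendsto_integral_filter_of_dominated_convergence (fun x => ‖g x‖)
    (Eventually.of_forall fun R => (hg.indicator (hm R)).aestronglyMeasurable)
    (Eventually.of_forall fun R => Eventually.of_forall fun x => norm_indicator_le_norm_self _ _)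
    hg.norm (Eventually.of_forall fun x => ?_)
  refine tendsto_const_nhds.congr' ?_
  filter_upwards [eventually_gt_atTop (4 * ‖x‖)] with R hR
  rw [indicator_of_notMem]
  simp only [mem_ofPred_eq, not_le]
  linarith

theorem exists_abs_le {f : EuclideanSpace ℝ (Fin N) → ℝ} (hf : Continuous f)
    (hc : HasCompactSupport f) : ∃ b : ℝ, ∀ x, |f x| ≤ b :=
  hf.bounded_above_of_compact_support hc

/-- The closed annulus `{r ≤ |x| ≤ s}`. -/
def annulus (N : ℕ) (r s : ℝ) : Set (EuclideanSpace ℝ (Fin N)) := {x | r ≤ ‖x‖ ∧ ‖x‖ ≤ s}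

theorem isCompact_annulus (r s : ℝ) : IsCompact (annulus N r s) := by
  refine (isCompact_closedBall (0 : EuclideanSpace ℝ (Fin N)) s).of_isClosed_subset
    ((isClosed_le continuous_const continuous_norm).inter
      (isClosed_le continuous_norm continuous_const)) fun x hx => ?_
  exact mem_closedBall_zero_iff.mpr hx.2

theorem integrable_indicator_annulus {f : EuclideanSpace ℝ (Fin N) → ℝ} (hf : Continuous f)
    (r s : ℝ) : Integrable ((annulus N r s).indicator f) :=
  (integrable_indicator_iff (isCompact_annulus r s).measurableSet).mpr
    (hf.continuousOn.integrableOn_compact (isCompact_annulus r s))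

/-- The energy density on the scale `R`, with the lower-order terms in scale-invariant form. -/
noncomputable def scaledDensity (a p : ℝ) (u : EuclideanSpace ℝ (Fin N) → ℝ) (R : ℝ) :
    EuclideanSpace ℝ (Fin N) → ℝ :=
  fun x => (lap u x ^ 2 + potentialDensity a p u x) + R⁻¹ ^ 4 * u x ^ 2
    + R⁻¹ ^ 2 * gradDot u u x + hessSq u x

namespace IsPositiveHenonSolution

/-- Young's inequality turns the integrability of `|x|ᵃ uᵖ⁺¹` into the decay of `R⁻⁴ ∫ u²` over
annuli of radius `R`. -/
theorem exists_tendsto_annulus (hu : IsPositiveHenonSolution N a p u) (ha : 0 ≤ a) (hp : 1 < p)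
    (hκ : (N : ℝ) < decayExponent a p)
    (hint : Integrable fun x => lap u x ^ 2 + potentialDensity a p u x) :
    ∃ τ : ℝ → ℝ, Tendsto τ atTop (𝓝 0) ∧ ∀ R, 0 < R →
      ∫ x, (annulus N (R / 4) (4 * R)).indicator
        (fun x => lap u x ^ 2 + potentialDensity a p u x) x ≤ τ R ∧
      ∫ x, (annulus N (R / 4) (4 * R)).indicator (fun x => R⁻¹ ^ 4 * u x ^ 2) x ≤ τ R := by
  have hp0 : 0 < p - 1 := by linarith
  obtain ⟨n, hn⟩ := exists_nat_ge (4 / (p - 1))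
  rw [div_le_iff₀ hp0] at hn
  obtain ⟨C', hC', hY⟩ := exists_young hp hn 1 one_pos
  set g : EuclideanSpace ℝ (Fin N) → ℝ := fun x => lap u x ^ 2 + potentialDensity a p u x with hg
  have hgc : Continuous g := ((hu.contDiff.lap (m := 0) (by norm_num)).continuous.pow 2).add
    (hu.continuous_density ha)
  have hg0 : ∀ x, 0 ≤ g x := fun x => add_nonneg (sq_nonneg _) (hu.density_nonneg x)
  -- `R⁻⁴ = ρ⁻⁴ / 256` for the inner radius `ρ = R / 4` of the annulus
  set D : ℝ := C' * (1 / 256) ^ ((p + 1) / (p - 1)) with hD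
  have hD0 : 0 ≤ D := by positivity
  set v := volume.real (Metric.ball (0 : EuclideanSpace ℝ (Fin N)) 1) with hv
  have hv0 : 0 ≤ v := measureReal_nonneg
  set t : ℝ → ℝ := fun R => ∫ x, {x | R / 4 ≤ ‖x‖}.indicator g x with ht
  have hm : ∀ R : ℝ, MeasurableSet {x : EuclideanSpace ℝ (Fin N) | R / 4 ≤ ‖x‖} := fun R =>
    (isClosed_le continuous_const continuous_norm).measurableSet
  have iT : ∀ R : ℝ, Integrable ({x : EuclideanSpace ℝ (Fin N) | R / 4 ≤ ‖x‖}.indicator g) :=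
    fun R => hint.indicator (hm R)
  refine ⟨fun R => t R + D * (16 ^ N * v * (R / 4) ^ ((N : ℝ) - decayExponent a p)), ?_,
    fun R hR => ⟨?_, ?_⟩⟩
  · have h1 : Tendsto (fun R : ℝ => (R / 4) ^ ((N : ℝ) - decayExponent a p)) atTop (𝓝 0) := by
      have := (tendsto_rpow_neg_atTop (y := decayExponent a p - N) (by linarith)).comp
        (tendsto_id.atTop_div_const (r := (4 : ℝ)) (by norm_num))
      simpa [Function.comp_def] using this
    simpa using (tendsto_integral_tail hint).add ((h1.const_mul (16 ^ N * v)).const_mul D)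
  · have h1 : ∫ x, (annulus N (R / 4) (4 * R)).indicator g x ≤ t R := by
      refine integral_mono (integrable_indicator_annulus hgc _ _) (iT R) fun x => ?_
      exact indicator_le_indicator_of_subset (fun y hy => hy.1) hg0 x
    have : 0 ≤ D * (16 ^ N * v * (R / 4) ^ ((N : ℝ) - decayExponent a p)) := by positivity
    dsimp only
    linarith
  · have hρ : 0 < R / 4 := by positivity
    let J : EuclideanSpace ℝ (Fin N) → ℝ :=
      (Metric.closedBall 0 (16 * (R / 4))).indicator fun _ => (R / 4) ^ (-decayExponent a p)
    have iJ : Integrable J := integrable_indicator_closedBall _ _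
    have hJ : ∫ x, J x = 16 ^ N * v * (R / 4) ^ ((N : ℝ) - decayExponent a p) :=
      integral_indicator_closedBall hρ (by norm_num) _
    have hpt : ∀ x, (annulus N (R / 4) (4 * R)).indicator (fun x => R⁻¹ ^ 4 * u x ^ 2) x ≤
        {x | R / 4 ≤ ‖x‖}.indicator g x + D * J x := by
      intro x
      by_cases hx : x ∈ annulus N (R / 4) (4 * R)
      · have hJx : J x = (R / 4) ^ (-decayExponent a p) := by
          refine indicator_of_mem (mem_closedBall_zero_iff.mpr ?_) _
          linarith [hx.2]
        rw [indicator_of_mem hx, indicator_of_mem (show x ∈ {x | R / 4 ≤ ‖x‖} from hx.1), hJx]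
        have h1 := hY (u x) (R⁻¹ ^ 4) (‖x‖ ^ a) 1 (hu.pos x).le (by positivity)
          (Real.rpow_pos_of_pos (hρ.trans_le hx.1) _) zero_le_one le_rfl
        have h2 := mul_le_mul_of_nonneg_left (rpow_mul_rpow_le (w := R⁻¹ ^ 4) (B := 1 / 256) ha hp
          (by positivity) (by norm_num) hρ (le_of_eq (by field_simp; norm_num)) hx.1) hC'.le
        simp only [one_pow, mul_one, one_mul] at h1
        have h3 : ‖x‖ ^ a * u x ^ (p + 1) ≤ g x := le_add_of_nonneg_left (sq_nonneg _)
        have h4 := hu.density_nonneg x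
        rw [potentialDensity] at h4
        rw [hD, mul_assoc C']
        linarith
      · rw [indicator_of_notMem hx]
        refine add_nonneg (indicator_nonneg (fun y _ => hg0 y) x) (mul_nonneg hD0 ?_)
        exact indicator_nonneg (fun _ _ => by positivity) x
    have iU : Integrable ((annulus N (R / 4) (4 * R)).indicator fun x => R⁻¹ ^ 4 * u x ^ 2) :=
      integrable_indicator_annulus (continuous_const.mul (hu.contDiff.continuous.pow 2)) _ _
    have := integral_mono iU ((iT R).add (iJ.const_mul D)) hpt
    refine this.trans_eq ?_
    dsimp only
    rw [← hJ, ← integral_const_mul]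
    exact integral_add (iT R) (iJ.const_mul D)

theorem continuous_scaledDensity (hu : IsPositiveHenonSolution N a p u) (ha : 0 ≤ a) (R : ℝ) :
    Continuous (scaledDensity a p u R) :=
  (((((hu.contDiff.lap (m := 0) (by norm_num)).continuous.pow 2).add
    (hu.continuous_density ha)).add (continuous_const.mul (hu.contDiff.continuous.pow 2))).add
    (continuous_const.mul (hu.contDiff.gradDot hu.contDiff (m := 0) (by norm_num)).continuous)).add
    (hu.contDiff.hessSq (m := 0) (by norm_num)).continuous

/-- All terms of the energy density tend to zero on the annuli `{R ≤ |x| ≤ 2R}`. -/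
theorem tendsto_scaledDensity (hu : IsPositiveHenonSolution N a p u) (ha : 0 ≤ a) (hp : 1 < p)
    (hκ : (N : ℝ) < decayExponent a p)
    (hint : Integrable fun x => lap u x ^ 2 + potentialDensity a p u x) :
    Tendsto (fun R : ℝ => ∫ x, (annulus N R (2 * R)).indicator (scaledDensity a p u R) x)
      atTop (𝓝 0) := by
  obtain ⟨τ, hτ, hle⟩ := hu.exists_tendsto_annulus ha hp hκ hint
  set f : EuclideanSpace ℝ (Fin N) → ℝ := fun x => cutoff N 2 x - cutoff N (1 / 4) x with hf
  have hfs : ContDiff ℝ 2 f := (contDiff_cutoff (n := 2) 2).sub (contDiff_cutoff (n := 2) (1 / 4))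
  have hfc : HasCompactSupport f :=
    (hasCompactSupport_cutoff two_pos).sub (hasCompactSupport_cutoff (by norm_num))
  obtain ⟨b₁, hb₁⟩ := exists_abs_le (hfs.continuous.pow 2)
    (HasCompactSupport.intro hfc.isCompact fun x hx => by simp [zero_of_notMem hx])
  obtain ⟨b₂, hb₂⟩ := exists_abs_le (hfs.gradDot hfs (m := 0) (by norm_num)).continuous
    (HasCompactSupport.intro hfc.isCompact fun x hx => gradDot_zero_of_notMem hx _)
  set b := max b₁ b₂ with hb
  have hb0 : 0 ≤ b := (abs_nonneg _).trans ((hb₁ 0).trans (le_max_left _ _))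
  have cu := hu.contDiff.continuous
  have clu : Continuous (lap u) := (hu.contDiff.lap (m := 0) (by norm_num)).continuous
  have cgu : Continuous (gradDot u u) :=
    (hu.contDiff.gradDot hu.contDiff (m := 0) (by norm_num)).continuous
  have chu : Continuous (hessSq u) := (hu.contDiff.hessSq (m := 0) (by norm_num)).continuous
  have cF := hu.continuous_density ha
  have hF0 := hu.density_nonneg
  have hQ0 : ∀ R x, 0 < R → 0 ≤ scaledDensity a p u R x := fun R x hR => by
    have := gradDot_self_nonneg u x
    have := hessSq_nonneg u x
    have := hF0 x
    simp only [scaledDensity]; positivity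
  refine squeeze_zero' (g := fun R => (2 + 6 * b + 148 * b ^ 2) * τ R) ?_ ?_
    (by simpa using hτ.const_mul (2 + 6 * b + 148 * b ^ 2))
  · filter_upwards [eventually_gt_atTop 0] with R hR
    exact integral_nonneg fun x => indicator_nonneg (fun y _ => hQ0 R y hR) x
  filter_upwards [eventually_gt_atTop 0] with R hR
  obtain ⟨hA, hU⟩ := hle R hR
  set A := annulus N (R / 4) (4 * R) with hAdef
  set ξ := dilate R f with hξ
  have hξs : ContDiff ℝ 2 ξ := hfs.dilate R
  have hξb : ∀ x, ξ x ^ 2 ≤ b := fun x =>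
    (le_abs_self _).trans ((hb₁ (R⁻¹ • x)).trans (le_max_left _ _))
  have hξg : ∀ x, gradDot ξ ξ x ≤ b * R⁻¹ ^ 2 := fun x => by
    rw [hξ, gradDot_dilate hfs, mul_comm]
    exact mul_le_mul_of_nonneg_right ((le_abs_self _).trans ((hb₂ _).trans (le_max_right _ _)))
      (by positivity)
  have hξ0 : ∀ x, x ∉ A → ξ =ᶠ[𝓝 x] fun _ => 0 := by
    intro x hx
    have hx' : ‖x‖ < R / 4 ∨ 4 * R < ‖x‖ := by
      by_contra! h; exact hx h
    rcases hx' with h | h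
    · filter_upwards [(isOpen_lt continuous_norm continuous_const).mem_nhds h] with y hy
      have hy' : ‖R⁻¹ • y‖ ≤ 1 / 4 := by
        rw [norm_inv_smul hR, div_le_iff₀ hR]; linarith [show ‖y‖ < R / 4 from hy]
      simp only [hξ, dilate, hf]
      rw [cutoff_eq_one two_pos (by linarith), cutoff_eq_one (by norm_num) hy', sub_self]
    · filter_upwards [(isOpen_lt continuous_const continuous_norm).mem_nhds h] with y hy
      have hy' : 4 ≤ ‖R⁻¹ • y‖ := by
        rw [norm_inv_smul hR, le_div_iff₀ hR]; exact le_of_lt hy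
      simp only [hξ, dilate, hf]
      rw [cutoff_eq_zero two_pos (by linarith), cutoff_eq_zero (by norm_num) (by linarith),
        sub_self]
  have hξ1 : ∀ x ∈ annulus N R (2 * R), ξ x = 1 := by
    intro x hx
    have h1 : 1 ≤ ‖R⁻¹ • x‖ := by rw [norm_inv_smul hR, le_div_iff₀ hR]; linarith [hx.1]
    have h2 : ‖R⁻¹ • x‖ ≤ 2 := by rw [norm_inv_smul hR, div_le_iff₀ hR]; exact hx.2
    simp only [hξ, dilate, hf]
    rw [cutoff_eq_one two_pos h2, cutoff_eq_zero (by norm_num) (by linarith), sub_zero]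
  have hξc : HasCompactSupport ξ :=
    HasCompactSupport.intro (isCompact_annulus (R / 4) (4 * R)) fun x hx => (hξ0 x hx).eq_of_nhds
  have hAK : IsCompact A := isCompact_annulus _ _
  have hξz : ∀ x, x ∉ A → ξ x = 0 := fun x hx => (hξ0 x hx).eq_of_nhds
  have hξgz : ∀ x, x ∉ A → gradDot ξ ξ x = 0 := fun x hx => by
    rw [gradDot_congr (hξ0 x hx) (hξ0 x hx)]; simp [gradDot]
  set g : EuclideanSpace ℝ (Fin N) → ℝ := fun x => lap u x ^ 2 + potentialDensity a p u x with hg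
  have hgc : Continuous g := (clu.pow 2).add cF
  have iA : Integrable (A.indicator g) := integrable_indicator_annulus hgc _ _
  have iU : Integrable (A.indicator fun x => R⁻¹ ^ 4 * u x ^ 2) :=
    integrable_indicator_annulus (continuous_const.mul (cu.pow 2)) _ _
  have iG : Integrable fun x => ξ x ^ 2 * gradDot u u x :=
    integrable_of_zero_off ((hξs.continuous.pow 2).mul cgu) hAK fun x hx => by simp [hξz x hx]
  have iH : Integrable fun x => (ξ x ^ 2) ^ 2 * hessSq u x :=
    integrable_of_zero_off (((hξs.continuous.pow 2).pow 2).mul chu) hAK fun x hx => by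
      simp [hξz x hx]
  have cgξ : Continuous (gradDot ξ ξ) := (hξs.gradDot hξs (m := 0) (by norm_num)).continuous
  have hRR : R * R⁻¹ = 1 := mul_inv_cancel₀ hR.ne'
  have hG : R⁻¹ ^ 2 * ∫ x, ξ x ^ 2 * gradDot u u x ≤ 6 * b * τ R := by
    have h1 := integral_sq_mul_gradDot_le (hu.contDiff.of_le (by norm_num))
      (hξs.of_le (by norm_num)) hξc
    have h2 : ∫ x, (4 * (u x ^ 2 * gradDot ξ ξ x) + 2 * (|u x| * |lap u x| * ξ x ^ 2)) ≤
        ∫ x, (5 * b * R ^ 2 * A.indicator (fun x => R⁻¹ ^ 4 * u x ^ 2) x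
          + b * R ^ 2 * A.indicator g x) := by
      refine integral_mono (integrable_of_zero_off ((continuous_const.mul ((cu.pow 2).mul cgξ)).add
        (continuous_const.mul ((cu.abs.mul clu.abs).mul (hξs.continuous.pow 2)))) hAK fun x hx => by
          simp [hξz x hx, hξgz x hx]) ((iU.const_mul _).add (iA.const_mul _)) fun x => ?_
      dsimp only
      by_cases hx : x ∈ A
      · rw [indicator_of_mem hx, indicator_of_mem hx]
        have k1 : u x ^ 2 * gradDot ξ ξ x ≤ u x ^ 2 * (b * R⁻¹ ^ 2) :=
          mul_le_mul_of_nonneg_left (hξg x) (sq_nonneg _)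
        have k2 : 2 * (|u x| * |lap u x|) ≤ R⁻¹ ^ 2 * u x ^ 2 + R ^ 2 * lap u x ^ 2 := by
          have := sq_nonneg (R⁻¹ * |u x| - R * |lap u x|)
          have e : R⁻¹ * |u x| * (R * |lap u x|) = |u x| * |lap u x| := by
            linear_combination |u x| * |lap u x| * hRR
          nlinarith [sq_abs (u x), sq_abs (lap u x)]
        have k3 : 2 * (|u x| * |lap u x| * ξ x ^ 2) ≤
            (R⁻¹ ^ 2 * u x ^ 2 + R ^ 2 * lap u x ^ 2) * b := by
          have : 2 * (|u x| * |lap u x| * ξ x ^ 2) = 2 * (|u x| * |lap u x|) * ξ x ^ 2 := by ring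
          rw [this]
          exact mul_le_mul k2 (hξb x) (sq_nonneg _) (by positivity)
        have k4 : 5 * b * R ^ 2 * (R⁻¹ ^ 4 * u x ^ 2) = 5 * b * (R⁻¹ ^ 2 * u x ^ 2) := by
          have : R ^ 2 * R⁻¹ ^ 4 = R⁻¹ ^ 2 := by field_simp
          linear_combination 5 * b * u x ^ 2 * this
        have k5 : b * R ^ 2 * lap u x ^ 2 ≤ b * R ^ 2 * g x :=
          mul_le_mul_of_nonneg_left (le_add_of_nonneg_right (hF0 x)) (by positivity)
        rw [k4]
        linarith
      · simp [hξz x hx, hξgz x hx, indicator_of_notMem hx]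
    rw [integral_add (iU.const_mul _) (iA.const_mul _), integral_const_mul,
      integral_const_mul] at h2
    have h3 : ∫ x, ξ x ^ 2 * gradDot u u x ≤ R ^ 2 * (6 * b * τ R) := by
      have k1 := mul_le_mul_of_nonneg_left hU (show 0 ≤ 5 * b * R ^ 2 by positivity)
      have k2 := mul_le_mul_of_nonneg_left hA (show 0 ≤ b * R ^ 2 by positivity)
      linarith
    calc _ ≤ R⁻¹ ^ 2 * (R ^ 2 * (6 * b * τ R)) := mul_le_mul_of_nonneg_left h3 (by positivity)
      _ = _ := by rw [← mul_assoc, ← mul_pow, inv_mul_cancel₀ hR.ne', one_pow, one_mul]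
  have hH : ∫ x, (ξ x ^ 2) ^ 2 * hessSq u x ≤ 148 * b ^ 2 * τ R := by
    have h1 := integral_sq_mul_hessSq_le (ξ := fun x => ξ x ^ 2)
      (hu.contDiff.of_le (m := 3) (by norm_num)) ((hξs.pow 2).of_le (by norm_num))
      (HasCompactSupport.intro hAK fun x hx => by simp [hξz x hx])
    have hgsq : ∀ x, gradDot (fun x => ξ x ^ 2) (fun x => ξ x ^ 2) x
        = 4 * (ξ x ^ 2 * gradDot ξ ξ x) := fun x => by
      have d := hξs.differentiable (by norm_num)
      rw [gradDot_pow_two d, gradDot_comm, gradDot_pow_two d]; ring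
    have h2 : ∫ x, (4 * ((ξ x ^ 2) ^ 2 * lap u x ^ 2)
          + 6 * (gradDot (fun x => ξ x ^ 2) (fun x => ξ x ^ 2) x * gradDot u u x)) ≤
        ∫ x, (4 * b ^ 2 * A.indicator g x + 24 * b * R⁻¹ ^ 2 * (ξ x ^ 2 * gradDot u u x)) := by
      simp only [hgsq]
      refine integral_mono (integrable_of_zero_off ((continuous_const.mul
        (((hξs.continuous.pow 2).pow 2).mul (clu.pow 2))).add (continuous_const.mul
        ((continuous_const.mul ((hξs.continuous.pow 2).mul cgξ)).mul cgu))) hAK fun x hx => by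
          simp [hξz x hx]) ((iA.const_mul _).add (iG.const_mul _)) fun x => ?_
      dsimp only
      by_cases hx : x ∈ A
      · rw [indicator_of_mem hx]
        have k0 : (ξ x ^ 2) ^ 2 ≤ b ^ 2 := pow_le_pow_left₀ (sq_nonneg _) (hξb x) 2
        have k1 : (ξ x ^ 2) ^ 2 * lap u x ^ 2 ≤ b ^ 2 * g x :=
          mul_le_mul k0 (le_add_of_nonneg_right (hF0 x)) (sq_nonneg _) (by positivity)
        have k2 := mul_le_mul_of_nonneg_left (hξg x)
          (mul_nonneg (sq_nonneg (ξ x)) (gradDot_self_nonneg u x))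
        linarith
      · simp [hξz x hx, indicator_of_notMem hx]
    rw [integral_add (iA.const_mul _) (iG.const_mul _), integral_const_mul,
      integral_const_mul] at h2
    have k1 := mul_le_mul_of_nonneg_left hA (show 0 ≤ 4 * b ^ 2 by positivity)
    have k2 := mul_le_mul_of_nonneg_left hG (show 0 ≤ 24 * b by positivity)
    linarith
  have hsum : ∫ x, (annulus N R (2 * R)).indicator (scaledDensity a p u R) x ≤
      ∫ x, ((1 * A.indicator g x + 1 * A.indicator (fun x => R⁻¹ ^ 4 * u x ^ 2) x
        + R⁻¹ ^ 2 * (ξ x ^ 2 * gradDot u u x)) + (ξ x ^ 2) ^ 2 * hessSq u x) := by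
    refine integral_mono (integrable_indicator_annulus (hu.continuous_scaledDensity ha R) _ _)
      ((integrable_lin_three iA iU iG _ _ _).add iH) fun x => ?_
    dsimp only
    by_cases hx : x ∈ annulus N R (2 * R)
    · have hxA : x ∈ A := ⟨by linarith [hx.1], by linarith [hx.2]⟩
      rw [indicator_of_mem hx, indicator_of_mem hxA, indicator_of_mem hxA, hξ1 x hx]
      simp only [scaledDensity, hg]
      linarith
    · rw [indicator_of_notMem hx]
      have k1 : 0 ≤ A.indicator g x :=
        indicator_nonneg (fun y _ => add_nonneg (sq_nonneg _) (hF0 y)) x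
      have k2 : 0 ≤ A.indicator (fun x => R⁻¹ ^ 4 * u x ^ 2) x :=
        indicator_nonneg (fun y _ => by positivity) x
      have k3 := gradDot_self_nonneg u x
      have k4 := hessSq_nonneg u x
      positivity
  rw [integral_add (integrable_lin_three iA iU iG _ _ _) iH, integral_lin_three iA iU iG] at hsum
  linarith

end IsPositiveHenonSolution

end Annulus

/-! ### The Pohozaev identity -/

section Pohozaev

variable {N : ℕ} {a p : ℝ} {u χ H : EuclideanSpace ℝ (Fin N) → ℝ}

theorem hasFDerivAt_norm_rpow_of_ne {x : EuclideanSpace ℝ (Fin N)} (hx : x ≠ 0) (a : ℝ) :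
    HasFDerivAt (fun x : EuclideanSpace ℝ (Fin N) => ‖x‖ ^ a)
      ((a * ‖x‖ ^ (a - 2)) • innerSL ℝ x) x := by
  have h1 := (hasStrictFDerivAt_norm_sq x).hasFDerivAt.rpow_const (p := a / 2)
    (Or.inl (by positivity))
  have e : ∀ (y : EuclideanSpace ℝ (Fin N)) (c : ℝ), (‖y‖ ^ 2) ^ (c / 2) = ‖y‖ ^ c := fun y c => by
    rw [← Real.rpow_natCast, ← Real.rpow_mul (norm_nonneg _)]; congr 1; push_cast; ring
  simp only [e] at h1
  rw [show a / 2 - 1 = (a - 2) / 2 by ring, e] at h1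
  have e' : (a * ‖x‖ ^ (a - 2)) • innerSL ℝ x
      = (a / 2 * ‖x‖ ^ (a - 2)) • 2 • (innerSL ℝ x : EuclideanSpace ℝ (Fin N) →L[ℝ] ℝ) := by
    ext y; simp; ring
  rw [e']
  exact h1

/-- The field `|x|ᵃ x` is differentiable, also at the origin. -/
theorem differentiable_norm_rpow_mul_coord (ha : 0 ≤ a) (i : Fin N) :
    Differentiable ℝ fun x : EuclideanSpace ℝ (Fin N) => ‖x‖ ^ a * x i := by
  intro x
  have hc : DifferentiableAt ℝ (fun x : EuclideanSpace ℝ (Fin N) => x i) x :=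
    (contDiff_coord (n := 1) i).differentiable (by norm_num) x
  rcases eq_or_ne x 0 with rfl | hx
  · rcases ha.eq_or_lt with rfl | ha
    · simpa using hc
    · -- a function that is continuous and vanishes at `0`, times one that is `O(|x|)`
      refine HasFDerivAt.differentiableAt (f' := 0) ?_
      rw [hasFDerivAt_iff_isLittleO_nhds_zero]
      have h1 : (fun h : EuclideanSpace ℝ (Fin N) => ‖h‖ ^ a) =o[𝓝 0] fun _ => (1 : ℝ) := by
        rw [Asymptotics.isLittleO_one_iff]
        have : Continuous fun h : EuclideanSpace ℝ (Fin N) => ‖h‖ ^ a :=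
          continuous_norm.rpow_const fun _ => Or.inr ha.le
        simpa [Real.zero_rpow ha.ne'] using this.tendsto 0
      have h2 : (fun h : EuclideanSpace ℝ (Fin N) => h i) =O[𝓝 0] fun h => h :=
        Asymptotics.IsBigO.of_bound 1 (Eventually.of_forall fun h => by
          rw [one_mul]; exact PiLp.norm_apply_le h i)
      have := h1.mul_isBigO h2.norm_right
      simp only [one_mul] at this
      simpa using this.of_norm_right
  · exact (hasFDerivAt_norm_rpow_of_ne hx a).differentiableAt.mul hc

theorem pd_norm_rpow_mul_coord {x : EuclideanSpace ℝ (Fin N)} (hx : x ≠ 0) (a : ℝ) (i : Fin N) :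
    pd i (fun x : EuclideanSpace ℝ (Fin N) => ‖x‖ ^ a * x i) x
      = ‖x‖ ^ a + a * ‖x‖ ^ (a - 2) * x i ^ 2 := by
  have hc : HasFDerivAt (fun x : EuclideanSpace ℝ (Fin N) => x i)
      (EuclideanSpace.proj i : EuclideanSpace ℝ (Fin N) →L[ℝ] ℝ) x :=
    (EuclideanSpace.proj i : EuclideanSpace ℝ (Fin N) →L[ℝ] ℝ).hasFDerivAt
  have h : HasFDerivAt (fun x : EuclideanSpace ℝ (Fin N) => ‖x‖ ^ a * x i) _ x :=
    (hasFDerivAt_norm_rpow_of_ne hx a).mul hc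
  rw [pd, h.fderiv]
  simp [EuclideanSpace.inner_single_right]
  ring

theorem norm_rpow_sub_two_mul {x : EuclideanSpace ℝ (Fin N)} (hx : x ≠ 0) (a : ℝ) :
    ‖x‖ ^ (a - 2) * ‖x‖ ^ 2 = ‖x‖ ^ a := by
  rw [← Real.rpow_natCast, ← Real.rpow_add (norm_pos_iff.mpr hx)]
  congr 1; push_cast; ring

/-- The divergence theorem for the field `|x|ᵃ H x`, where `div (|x|ᵃ x) = (N + a) |x|ᵃ`. -/
theorem integral_norm_rpow_mul_radial [NeZero N] (ha : 0 ≤ a) (hH : ContDiff ℝ 1 H)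
    (hc : HasCompactSupport H) :
    ∫ x, ‖x‖ ^ a * radial H x = -(N + a) * ∫ x, ‖x‖ ^ a * H x := by
  have : Nonempty (Fin N) := ⟨0⟩
  have hdH := hH.differentiable (by norm_num)
  have cn : Continuous fun x : EuclideanSpace ℝ (Fin N) => ‖x‖ ^ a :=
    continuous_norm.rpow_const fun _ => Or.inr ha
  have hne : ∀ᵐ x : EuclideanSpace ℝ (Fin N), x ≠ 0 := by
    simp [ae_iff, measure_singleton]
  let V : Fin N → EuclideanSpace ℝ (Fin N) → ℝ := fun i x => ‖x‖ ^ a * x i * H x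
  have hV : ∀ i, Differentiable ℝ (V i) := fun i =>
    (differentiable_norm_rpow_mul_coord ha i).mul hdH
  have hVc : ∀ i, HasCompactSupport (V i) := fun i => hc.mul_left
  have hpd : ∀ i x, x ≠ 0 → pd i (V i) x = (‖x‖ ^ a + a * ‖x‖ ^ (a - 2) * x i ^ 2) * H x
      + ‖x‖ ^ a * x i * pd i H x := fun i x hx => by
    rw [pd_mul (differentiable_norm_rpow_mul_coord ha i) hdH]
    dsimp only
    rw [pd_norm_rpow_mul_coord hx]
  have hi : ∀ i, Integrable (pd i (V i)) := by
    intro i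
    have cpd : Continuous (pd i H) := (hH.pd (m := 0) (by simp) i).continuous
    have hb : Integrable fun x => (1 + a) * (‖x‖ ^ a * |H x|) + ‖x‖ ^ a * |x i| * |pd i H x| :=
      integrable_of_zero_off ((continuous_const.mul (cn.mul hH.continuous.abs)).add
        ((cn.mul (contDiff_coord (n := 0) i).continuous.abs).mul cpd.abs)) hc.isCompact
        fun x hx => by simp [zero_of_notMem hx, pd_zero_of_notMem hx]
    refine hb.mono' (measurable_fderiv_apply_const ℝ (V i) _).aestronglyMeasurable ?_
    filter_upwards [hne] with x hx
    have hxi : x i ^ 2 ≤ ‖x‖ ^ 2 := by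
      have := PiLp.norm_apply_le x i
      exact sq_le_sq' (by linarith [neg_abs_le (x i), Real.norm_eq_abs (x i)])
        ((le_abs_self _).trans this)
    have h0 : 0 ≤ ‖x‖ ^ (a - 2) := by positivity
    have h1 : a * ‖x‖ ^ (a - 2) * x i ^ 2 ≤ a * ‖x‖ ^ a := by
      rw [← norm_rpow_sub_two_mul hx a, mul_assoc]
      exact mul_le_mul_of_nonneg_left (mul_le_mul_of_nonneg_left hxi h0) ha
    rw [hpd i x hx]
    refine (norm_add_le _ _).trans (add_le_add ?_ ?_)
    · rw [norm_mul, Real.norm_of_nonneg (by positivity), Real.norm_eq_abs]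
      calc _ ≤ (‖x‖ ^ a + a * ‖x‖ ^ a) * |H x| := by gcongr
        _ = _ := by ring
    · rw [norm_mul, norm_mul, Real.norm_of_nonneg (by positivity : 0 ≤ ‖x‖ ^ a),
        Real.norm_eq_abs, Real.norm_eq_abs]
  have crad : Continuous (radial H) := (hH.radial (m := 0) (by simp)).continuous
  have i1 : Integrable fun x => ‖x‖ ^ a * H x :=
    integrable_of_zero_off (cn.mul hH.continuous) hc.isCompact fun x hx => by
      simp [zero_of_notMem hx]
  have i2 : Integrable fun x => ‖x‖ ^ a * radial H x :=
    integrable_of_zero_off (cn.mul crad) hc.isCompact fun x hx => by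
      simp [radial_zero_of_notMem hx]
  have hsum : ∫ x, ∑ i, pd i (V i) x = 0 := by
    rw [integral_finsetSum _ fun i _ => hi i]
    exact Finset.sum_eq_zero fun i _ => integral_pd_eq_zero_of_integrable (hV i) (hVc i) i (hi i)
  have hcongr : ∫ x, ∑ i, pd i (V i) x =
      ∫ x, ((N + a) * (‖x‖ ^ a * H x) + ‖x‖ ^ a * radial H x) := by
    refine integral_congr_ae ?_
    filter_upwards [hne] with x hx
    simp only [hpd _ x hx, Finset.sum_add_distrib, ← Finset.sum_mul, ← Finset.mul_sum,
      sum_coord_sq, Finset.sum_const, Finset.card_univ, Fintype.card_fin, nsmul_eq_mul, radial,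
      mul_assoc, norm_rpow_sub_two_mul hx a]
    ring
  rw [hcongr, integral_add (i1.const_mul _) i2, integral_const_mul] at hsum
  linarith

theorem radial_mul {f g : EuclideanSpace ℝ (Fin N) → ℝ} (hf : Differentiable ℝ f)
    (hg : Differentiable ℝ g) (x) :
    radial (fun x => f x * g x) x = f x * radial g x + g x * radial f x := by
  simp only [radial, pd_mul hf hg, Finset.mul_sum, ← Finset.sum_add_distrib]
  exact Finset.sum_congr rfl fun i _ => by ring

theorem gradDot_radial_le (hu : ContDiff ℝ 2 u) (x) :
    gradDot (radial u) (radial u) x ≤ 2 * gradDot u u x + 2 * (‖x‖ ^ 2 * hessSq u x) := by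
  have h : ∀ i, pd i (radial u) x * pd i (radial u) x ≤
      2 * (pd i u x * pd i u x) + 2 * (‖x‖ ^ 2 * ∑ j, pd j (pd i u) x ^ 2) := by
    intro i
    have h1 := Finset.sum_mul_sq_le_sq_mul_sq Finset.univ (fun j => x j)
      (fun j => pd j (pd i u) x)
    rw [sum_coord_sq] at h1
    rw [pd_radial hu]
    simp only [pd_comm hu i]
    nlinarith [sq_nonneg (pd i u x - ∑ j, x j * pd j (pd i u) x)]
  calc _ ≤ ∑ i, (2 * (pd i u x * pd i u x) + 2 * (‖x‖ ^ 2 * ∑ j, pd j (pd i u) x ^ 2)) :=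
        Finset.sum_le_sum fun i _ => h i
    _ = _ := by simp only [gradDot, hessSq, Finset.sum_add_distrib, ← Finset.mul_sum]

theorem abs_mul_two_mul_add_le {l g r X Y : ℝ} (hg : g ^ 2 ≤ X) (hr : r ^ 2 ≤ Y) :
    |l * (2 * g + r)| ≤ 2 * l ^ 2 + X + Y := by
  rw [abs_le]
  constructor <;> nlinarith [sq_nonneg (l + g), sq_nonneg (l - g), sq_nonneg (l + r),
    sq_nonneg (l - r)]

/-- The integrand collecting the terms of the localized Pohozaev identity that contain derivatives
of the cutoff `χ`. -/
noncomputable def pohozaevError (a p : ℝ) (u χ : EuclideanSpace ℝ (Fin N) → ℝ) :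
    EuclideanSpace ℝ (Fin N) → ℝ := fun x =>
  -(1 / (p + 1)) * (potentialDensity a p u x * radial χ x) + 1 / 2 * (lap u x ^ 2 * radial χ x)
    - lap u x * (2 * gradDot χ (radial u) x + radial u x * lap χ x)
    - ((N : ℝ) - 4) / 2 * (lap u x * (2 * gradDot χ u x + u x * lap χ x))

namespace IsPositiveHenonSolution

/-- The Pohozaev identity localized by a cutoff `χ`: the equation tested against
`(x · ∇u) χ + (N - 4) / 2 · u χ`. -/
theorem pohozaev [NeZero N] (hu : IsPositiveHenonSolution N a p u) (ha : 0 ≤ a) (hp : 1 < p)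
    (hχ : ContDiff ℝ 4 χ) (hc : HasCompactSupport χ) :
    (((N : ℝ) + a) / (p + 1) - ((N : ℝ) - 4) / 2) * ∫ x, potentialDensity a p u x * χ x =
      ∫ x, pohozaevError a p u χ x := by
  have hu4 := hu.contDiff
  have hu2 : ContDiff ℝ 2 u := hu4.of_le (by norm_num)
  have hχ2 : ContDiff ℝ 2 χ := hχ.of_le (by norm_num)
  have hl : ContDiff ℝ 2 (lap u) := hu4.lap (by norm_num)
  have hr : ContDiff ℝ 3 (radial u) := hu4.radial (by norm_num)
  have cF := hu.continuous_density ha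
  have cl := hl.continuous
  have cχ := hχ.continuous
  have crχ : Continuous (radial χ) := (hχ.radial (m := 0) (by norm_num)).continuous
  have clχ : Continuous (lap χ) := (hχ.lap (m := 0) (by norm_num)).continuous
  have crl : Continuous (radial (lap u)) := (hl.radial (m := 0) (by norm_num)).continuous
  have cgr : Continuous (gradDot χ (radial u)) :=
    ((hχ.of_le (by norm_num)).gradDot hr (m := 0) (by norm_num)).continuous
  have cgu : Continuous (gradDot χ u) := (hχ.gradDot hu4 (m := 0) (by norm_num)).continuous
  have hK := hc.isCompact
  have iP : Integrable fun x => potentialDensity a p u x * χ x :=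
    integrable_of_zero_off (cF.mul cχ) hK fun x hx => by simp [zero_of_notMem hx]
  have iPr : Integrable fun x => potentialDensity a p u x * radial χ x :=
    integrable_of_zero_off (cF.mul crχ) hK fun x hx => by simp [radial_zero_of_notMem hx]
  have iA : Integrable fun x => lap u x ^ 2 * χ x :=
    integrable_of_zero_off ((cl.pow 2).mul cχ) hK fun x hx => by simp [zero_of_notMem hx]
  have iAr : Integrable fun x => lap u x ^ 2 * radial χ x :=
    integrable_of_zero_off ((cl.pow 2).mul crχ) hK fun x hx => by simp [radial_zero_of_notMem hx]
  have iB : Integrable fun x => χ x * (lap u x * radial (lap u) x) :=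
    integrable_of_zero_off (cχ.mul (cl.mul crl)) hK fun x hx => by simp [zero_of_notMem hx]
  have iE : Integrable fun x => lap u x * (2 * gradDot χ (radial u) x + radial u x * lap χ x) :=
    integrable_of_zero_off (cl.mul ((continuous_const.mul cgr).add (hr.continuous.mul clχ))) hK
      fun x hx => by simp [gradDot_zero_of_notMem_left hx, lap_zero_of_notMem hx]
  have iE' : Integrable fun x => lap u x * (2 * gradDot χ u x + u x * lap χ x) :=
    integrable_of_zero_off (cl.mul ((continuous_const.mul cgu).add (hu4.continuous.mul clχ))) hK
      fun x hx => by simp [gradDot_zero_of_notMem_left hx, lap_zero_of_notMem hx]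
  -- the test function `u χ`
  have t1 : ∫ x, potentialDensity a p u x * χ x = (∫ x, lap u x ^ 2 * χ x) +
      ∫ x, lap u x * (2 * gradDot χ u x + u x * lap χ x) := by
    have h := integral_lap_mul hl (hu2.mul hχ2) hc.mul_left
    have e1 : ∀ x, lap (lap u) x * (u x * χ x) = potentialDensity a p u x * χ x := fun x => by
      rw [hu.lap_lap, hu.density_eq]; ring
    have e2 : ∀ x, lap u x * lap (fun x => u x * χ x) x = lap u x ^ 2 * χ x
        + lap u x * (2 * gradDot χ u x + u x * lap χ x) := fun x => by
      rw [lap_mul hu2 hχ2, gradDot_comm u χ]; ring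
    simp only [e1, e2] at h
    rw [h, integral_add iA iE']
  -- the test function `(x · ∇u) χ`
  have t2 : ∫ x, ‖x‖ ^ a * u x ^ p * (radial u x * χ x) = 2 * (∫ x, lap u x ^ 2 * χ x)
      + 1 * (∫ x, χ x * (lap u x * radial (lap u) x))
      + 1 * ∫ x, lap u x * (2 * gradDot χ (radial u) x + radial u x * lap χ x) := by
    have hr2 : ContDiff ℝ 2 (radial u) := hr.of_le (by norm_num)
    have h := integral_lap_mul hl (hr2.mul hχ2) hc.mul_left
    have e2 : ∀ x, lap u x * lap (fun x => radial u x * χ x) x = 2 * (lap u x ^ 2 * χ x)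
        + 1 * (χ x * (lap u x * radial (lap u) x))
        + 1 * (lap u x * (2 * gradDot χ (radial u) x + radial u x * lap χ x)) := fun x => by
      rw [lap_mul hr2 hχ2, gradDot_comm (radial u) χ, lap_radial (hu4.of_le (by norm_num))]; ring
    simp only [e2, hu.lap_lap] at h
    rw [h, integral_lin_three iA iB iE]
  -- the divergence theorem on the left side of `t2`
  have t3 : (p + 1) * (∫ x, ‖x‖ ^ a * u x ^ p * (radial u x * χ x)) =
      -(N + a) * (∫ x, potentialDensity a p u x * χ x)
        - ∫ x, potentialDensity a p u x * radial χ x := by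
    have hup : ContDiff ℝ 1 fun x => u x ^ (p + 1) :=
      (hu4.of_le (by norm_num)).rpow_const_of_ne fun x => (hu.pos x).ne'
    have hrp : ∀ x, radial (fun x => u x ^ (p + 1)) x = (p + 1) * u x ^ p * radial u x := by
      intro x
      have : ∀ i, pd i (fun x => u x ^ (p + 1)) x = (p + 1) * u x ^ p * pd i u x := fun i => by
        have h := ((hu4.differentiable (by norm_num) x).hasFDerivAt.rpow_const (p := p + 1)
          (Or.inl (hu.pos x).ne'))
        rw [pd, h.fderiv]
        simp [pd]
      simp only [radial, this, Finset.mul_sum]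
      exact Finset.sum_congr rfl fun i _ => by ring
    have h := integral_norm_rpow_mul_radial (H := fun x => u x ^ (p + 1) * χ x) ha
      (hup.mul (hχ.of_le (by norm_num))) hc.mul_left
    have e1 : ∀ x, ‖x‖ ^ a * radial (fun x => u x ^ (p + 1) * χ x) x =
        (p + 1) * (‖x‖ ^ a * u x ^ p * (radial u x * χ x))
          + potentialDensity a p u x * radial χ x := fun x => by
      rw [radial_mul (hup.differentiable (by norm_num)) (hχ.differentiable (by norm_num)), hrp,
        potentialDensity]
      ring
    have e2 : ∀ x, ‖x‖ ^ a * (u x ^ (p + 1) * χ x) = potentialDensity a p u x * χ x := fun x => by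
      rw [potentialDensity]; ring
    have iL : Integrable fun x => ‖x‖ ^ a * u x ^ p * (radial u x * χ x) :=
      integrable_of_zero_off ((continuous_norm_rpow_mul_rpow ha hu4.continuous hu.pos p).mul
        (hr.continuous.mul cχ)) hK fun x hx => by simp [zero_of_notMem hx]
    simp only [e1, e2] at h
    rw [integral_add (iL.const_mul _) iPr, integral_const_mul] at h
    linarith
  -- the divergence theorem for `|Δu|² χ x`
  have t4 : 2 * (∫ x, χ x * (lap u x * radial (lap u) x)) =
      -N * (∫ x, lap u x ^ 2 * χ x) - ∫ x, lap u x ^ 2 * radial χ x := by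
    have hl1 : ContDiff ℝ 1 (lap u) := hl.of_le (by norm_num)
    have dl := hl1.differentiable (by norm_num)
    have h := integral_norm_rpow_mul_radial (a := 0) (H := fun x => (lap u x * lap u x) * χ x) le_rfl
      ((hl1.mul hl1).mul (hχ.of_le (by norm_num))) hc.mul_left
    have e1 : ∀ x, radial (fun x => (lap u x * lap u x) * χ x) x =
        2 * (χ x * (lap u x * radial (lap u) x)) + lap u x ^ 2 * radial χ x := fun x => by
      rw [radial_mul (dl.fun_mul dl) (hχ.differentiable (by norm_num)), radial_mul dl dl]
      ring
    have e2 : ∀ x, (lap u x * lap u x) * χ x = lap u x ^ 2 * χ x := fun x => by ring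
    simp only [Real.rpow_zero, one_mul, add_zero] at h
    simp only [e1] at h
    simp only [e2] at h
    rw [integral_add (iB.const_mul 2) iAr, integral_const_mul] at h
    linarith
  -- collect the terms with derivatives of `χ`
  have hE : ∫ x, pohozaevError a p u χ x =
      -(1 / (p + 1)) * (∫ x, potentialDensity a p u x * radial χ x)
      + 1 / 2 * (∫ x, lap u x ^ 2 * radial χ x)
      + (-1) * (∫ x, lap u x * (2 * gradDot χ (radial u) x + radial u x * lap χ x))
      - ((N : ℝ) - 4) / 2 * ∫ x, lap u x * (2 * gradDot χ u x + u x * lap χ x) := by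
    rw [← integral_lin_three iPr iAr iE, ← integral_const_mul,
      ← integral_sub (integrable_lin_three iPr iAr iE _ _ _) (iE'.const_mul _)]
    congr 1 with x
    simp only [pohozaevError]
    ring
  have hp1 : p + 1 ≠ 0 := by positivity
  have t3' : ∫ x, ‖x‖ ^ a * u x ^ p * (radial u x * χ x) =
      -((N + a) / (p + 1)) * (∫ x, potentialDensity a p u x * χ x)
        - 1 / (p + 1) * ∫ x, potentialDensity a p u x * radial χ x := by
    rw [← mul_right_inj' hp1, t3]
    field_simp
  rw [hE]
  linear_combination t3' - t2 - ((N : ℝ) - 4) / 2 * t1 - 1 / 2 * t4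

theorem integrable_pohozaevError (hu : IsPositiveHenonSolution N a p u) (ha : 0 ≤ a)
    (hχ : ContDiff ℝ 4 χ) (hc : HasCompactSupport χ) : Integrable (pohozaevError a p u χ) := by
  have hu4 := hu.contDiff
  have cF := hu.continuous_density ha
  have hr : ContDiff ℝ 3 (radial u) := hu4.radial (by norm_num)
  have cl : Continuous (lap u) := (hu4.lap (m := 0) (by norm_num)).continuous
  have crχ : Continuous (radial χ) := (hχ.radial (m := 0) (by norm_num)).continuous
  have clχ : Continuous (lap χ) := (hχ.lap (m := 0) (by norm_num)).continuous
  have cgr : Continuous (gradDot χ (radial u)) :=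
    ((hχ.of_le (by norm_num)).gradDot hr (m := 0) (by norm_num)).continuous
  have cgu : Continuous (gradDot χ u) := (hχ.gradDot hu4 (m := 0) (by norm_num)).continuous
  refine integrable_of_zero_off ((((continuous_const.mul (cF.mul crχ)).add
    (continuous_const.mul ((cl.pow 2).mul crχ))).sub
    (cl.mul ((continuous_const.mul cgr).add (hr.continuous.mul clχ)))).sub
    (continuous_const.mul (cl.mul ((continuous_const.mul cgu).add (hu4.continuous.mul clχ)))))
    hc.isCompact fun x hx => ?_
  simp [pohozaevError, radial_zero_of_notMem hx, gradDot_zero_of_notMem_left hx,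
    lap_zero_of_notMem hx]

/-- With the standard cutoff of radius `R` the error terms live on `{R ≤ |x| ≤ 2R}` and are
controlled by the scaled energy density there. -/
theorem exists_pohozaevError_le (hu : IsPositiveHenonSolution N a p u) (hp : 1 < p) :
    ∃ K : ℝ, ∀ R x, 0 < R → pohozaevError a p u (cutoff N R) x ≤
      K * (annulus N R (2 * R)).indicator (scaledDensity a p u R) x := by
  have hb2 : ContDiff ℝ 2 (bump N) := (bump N).contDiff
  obtain ⟨b₁, hb₁⟩ := exists_abs_le (hb2.gradDot hb2 (m := 0) (by norm_num)).continuous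
    (HasCompactSupport.intro (bump N).hasCompactSupport.isCompact fun x hx =>
      gradDot_zero_of_notMem hx _)
  obtain ⟨b₂, hb₂⟩ := exists_abs_le ((hb2.lap (m := 0) (by norm_num)).continuous.pow 2)
    (HasCompactSupport.intro (bump N).hasCompactSupport.isCompact fun x hx => by
      simp [lap_zero_of_notMem hx])
  set b := max b₁ b₂ with hb
  have hb0 : 0 ≤ b := (abs_nonneg _).trans ((hb₁ 0).trans (le_max_left _ _))
  refine ⟨(1 + 4 * b) + (1 + 4 * b) + (2 + 12 * b) + |((N : ℝ) - 4) / 2| * (2 + 2 * b),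
    fun R x hR => ?_⟩
  set χ := cutoff N R with hχ
  by_cases hx : x ∈ annulus N R (2 * R)
  swap
  · have hloc : ∃ c : ℝ, χ =ᶠ[𝓝 x] fun _ => c := by
      have hx' : ‖x‖ < R ∨ 2 * R < ‖x‖ := by
        by_contra! h; exact hx h
      rcases hx' with h | h
      · exact ⟨1, cutoff_eventuallyEq_one hR h⟩
      · exact ⟨0, cutoff_eventuallyEq_zero hR h⟩
    obtain ⟨c, hc⟩ := hloc
    have h1 : ∀ i, pd i χ x = 0 := fun i => by rw [pd_congr hc, pd_const]
    have h2 : lap χ x = 0 := by rw [lap_congr hc]; simp [lap]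
    rw [indicator_of_notMem hx]
    simp [pohozaevError, radial, gradDot, h1, h2]
  rw [indicator_of_mem hx]
  have hg : gradDot χ χ x ≤ b * R⁻¹ ^ 2 := by
    rw [hχ, cutoff, gradDot_dilate hb2, mul_comm]
    exact mul_le_mul_of_nonneg_right ((le_abs_self _).trans ((hb₁ _).trans (le_max_left _ _)))
      (by positivity)
  have hl : lap χ x ^ 2 ≤ b * R⁻¹ ^ 4 := by
    rw [hχ, cutoff, lap_dilate hb2, mul_pow, ← pow_mul, mul_comm]
    exact mul_le_mul_of_nonneg_right ((le_abs_self _).trans ((hb₂ _).trans (le_max_right _ _)))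
      (by positivity)
  have hRi : R⁻¹ ^ 2 * R ^ 2 = 1 := by rw [← mul_pow, inv_mul_cancel₀ hR.ne', one_pow]
  have hx2 : ‖x‖ ^ 2 ≤ 4 * R ^ 2 := by nlinarith [hx.2, norm_nonneg x]
  have hU := gradDot_self_nonneg u x
  have hH := hessSq_nonneg u x
  have hF := hu.density_nonneg x
  set Q := scaledDensity a p u R x with hQ
  set G := R⁻¹ ^ 2 * gradDot u u x with hG
  set U := R⁻¹ ^ 4 * u x ^ 2 with hUd
  have hG0 : 0 ≤ G := by positivity
  have hU0 : 0 ≤ U := by positivity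
  have hS0 := sq_nonneg (lap u x)
  have hQe : Q = lap u x ^ 2 + potentialDensity a p u x + U + G + hessSq u x := rfl
  have hr : |radial χ x| ≤ 1 + 4 * b := by
    have h1 : radial χ x ^ 2 ≤ 4 * b := by
      have h2 := mul_le_mul hx2 hg (gradDot_self_nonneg _ _) (by positivity)
      calc _ ≤ 4 * R ^ 2 * (b * R⁻¹ ^ 2) := (radial_sq_le χ x).trans h2
        _ = _ := by linear_combination 4 * b * hRi
    refine abs_le_of_sq_le_sq (h1.trans ?_) (by positivity)
    nlinarith
  -- each error term is at most a multiple of `Q` in absolute value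
  have e1 : |1 / (p + 1) * (potentialDensity a p u x * radial χ x)| ≤ (1 + 4 * b) * Q := by
    rw [abs_mul, abs_mul, abs_of_nonneg hF, abs_of_nonneg (by positivity)]
    have h1 : 1 / (p + 1) ≤ 1 := by rw [div_le_one (by linarith)]; linarith
    calc _ ≤ 1 * (Q * (1 + 4 * b)) := by
          refine mul_le_mul h1 (mul_le_mul (by linarith) hr (abs_nonneg _) (by linarith))
            (by positivity) zero_le_one
      _ = _ := by ring
  have e2 : |1 / 2 * (lap u x ^ 2 * radial χ x)| ≤ (1 + 4 * b) * Q := by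
    rw [abs_mul, abs_mul, abs_of_nonneg hS0, abs_of_nonneg (by norm_num)]
    calc _ ≤ 1 * (Q * (1 + 4 * b)) := by
          refine mul_le_mul (by norm_num) (mul_le_mul (by linarith) hr (abs_nonneg _) (by linarith))
            (by positivity) zero_le_one
      _ = _ := by ring
  have q1 : gradDot χ u x ^ 2 ≤ b * G := by
    refine (gradDot_sq_le _ _ _).trans ((mul_le_mul_of_nonneg_right hg hU).trans_eq ?_)
    rw [hG]; ring
  have q2 : (u x * lap χ x) ^ 2 ≤ b * U := by
    rw [mul_pow]
    refine (mul_le_mul_of_nonneg_left hl (sq_nonneg _)).trans_eq ?_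
    rw [hUd]; ring
  have q3 : (radial u x * lap χ x) ^ 2 ≤ 4 * b * G := by
    rw [mul_pow]
    have h1 : radial u x ^ 2 ≤ 4 * R ^ 2 * gradDot u u x :=
      (radial_sq_le u x).trans (mul_le_mul_of_nonneg_right hx2 hU)
    refine (mul_le_mul h1 hl (sq_nonneg _) (by positivity)).trans_eq ?_
    rw [hG]
    linear_combination 4 * b * gradDot u u x * R⁻¹ ^ 2 * hRi
  have q4 : gradDot χ (radial u) x ^ 2 ≤ 2 * b * G + 8 * b * hessSq u x := by
    have h1 : gradDot (radial u) (radial u) x ≤ 2 * gradDot u u x + 8 * R ^ 2 * hessSq u x := by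
      have := gradDot_radial_le (hu.contDiff.of_le (by norm_num)) x
      have := mul_le_mul_of_nonneg_right hx2 hH
      linarith
    refine (gradDot_sq_le _ _ _).trans ((mul_le_mul hg h1 (gradDot_self_nonneg _ _)
      (by positivity)).trans_eq ?_)
    rw [hG]
    linear_combination 8 * b * hessSq u x * hRi
  have z1 := mul_nonneg hb0 hG0
  have z2 := mul_nonneg hb0 hU0
  have z3 := mul_nonneg hb0 hH
  have z4 := mul_nonneg hb0 hF
  have z5 := mul_nonneg hb0 hS0
  have e3 : |lap u x * (2 * gradDot χ (radial u) x + radial u x * lap χ x)| ≤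
      (2 + 12 * b) * Q := by
    refine (abs_mul_two_mul_add_le q4 q3).trans ?_
    rw [hQe]; linarith
  have e4 : |lap u x * (2 * gradDot χ u x + u x * lap χ x)| ≤ (2 + 2 * b) * Q := by
    refine (abs_mul_two_mul_add_le q1 q2).trans ?_
    rw [hQe]; linarith
  have e5 : |((N : ℝ) - 4) / 2 * (lap u x * (2 * gradDot χ u x + u x * lap χ x))| ≤
      |((N : ℝ) - 4) / 2| * ((2 + 2 * b) * Q) := by
    rw [abs_mul]; exact mul_le_mul_of_nonneg_left e4 (abs_nonneg _)
  have a1 := neg_le_of_abs_le e1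
  have a2 := le_of_abs_le e2
  have a3 := neg_le_of_abs_le e3
  have a5 := neg_le_of_abs_le e5
  simp only [pohozaevError]
  linarith

end IsPositiveHenonSolution

end Pohozaev

theorem theorem3 (N : ℕ) (hN : 5 ≤ N) (a p : ℝ) (ha : 0 ≤ a) (hp : 1 < p)
    (hpN : p < ((N : ℝ) + 4 + 2 * a) / ((N : ℝ) - 4)) :
    ¬ ∃ u : EuclideanSpace ℝ (Fin N) → ℝ,
      IsPositiveHenonSolution N a p u ∧ HasFiniteHenonMorseIndex N a p u := by
  rintro ⟨u, hu, hM⟩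
  have : NeZero N := ⟨by omega⟩
  have : Nonempty (Fin N) := ⟨0⟩
  have hN4 : (0 : ℝ) < (N : ℝ) - 4 := by
    have : (5 : ℝ) ≤ N := by exact_mod_cast hN
    linarith
  have hκ := lt_decayExponent hN hp hpN
  obtain ⟨R₀, hR₀, hst⟩ := exists_stable_outside_ball ha hu.contDiff.continuous hu.pos hM
  have hint := hu.integrable_energy ha hp hκ hR₀ hst
  have htend := hu.tendsto_scaledDensity ha hp hκ hint
  obtain ⟨K, hK⟩ := hu.exists_pohozaevError_le hp
  have hδ : 0 < ((N : ℝ) + a) / (p + 1) - ((N : ℝ) - 4) / 2 := by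
    rw [lt_div_iff₀ hN4] at hpN
    rw [sub_pos, div_lt_div_iff₀ two_pos (by linarith)]
    linarith
  set δ := ((N : ℝ) + a) / (p + 1) - ((N : ℝ) - 4) / 2 with hδd
  set F := potentialDensity a p u with hF
  have cF : Continuous F := hu.continuous_density ha
  have hF0 := hu.density_nonneg
  set B := Metric.closedBall (0 : EuclideanSpace ℝ (Fin N)) 1 with hB
  have iB : Integrable (B.indicator F) :=
    (integrable_indicator_iff Metric.isClosed_closedBall.measurableSet).mpr
      (cF.continuousOn.integrableOn_compact (isCompact_closedBall _ _))
  have hpos : 0 < ∫ x, B.indicator F x := by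
    rw [integral_pos_iff_support_of_nonneg (fun x => indicator_nonneg (fun y _ => hF0 y) x) iB]
    have hsub : Metric.ball (0 : EuclideanSpace ℝ (Fin N)) 1 \ {0} ⊆
        Function.support (B.indicator F) := by
      rintro x ⟨hx, hx0⟩
      rw [Function.mem_support, indicator_of_mem (Metric.ball_subset_closedBall hx)]
      exact (mul_pos (Real.rpow_pos_of_pos (norm_pos_iff.mpr hx0) _)
        (Real.rpow_pos_of_pos (hu.pos x) _)).ne'
    refine lt_of_lt_of_le ?_ (measure_mono hsub)
    rw [measure_sdiff_null (measure_singleton _)]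
    exact Metric.measure_ball_pos _ _ one_pos
  have hle : ∀ᶠ R : ℝ in atTop, δ * ∫ x, B.indicator F x ≤
      K * ∫ x, (annulus N R (2 * R)).indicator (scaledDensity a p u R) x := by
    filter_upwards [eventually_ge_atTop 1] with R hR
    have hR0 : 0 < R := by linarith
    have hχ : ContDiff ℝ 4 (cutoff N R) := contDiff_cutoff (n := 4) R
    have hc : HasCompactSupport (cutoff N R) := hasCompactSupport_cutoff hR0
    have h1 : ∫ x, B.indicator F x ≤ ∫ x, F x * cutoff N R x := by
      refine integral_mono iB (integrable_of_zero_off (cF.mul hχ.continuous) hc.isCompact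
        fun x hx => by simp [zero_of_notMem hx]) fun x => ?_
      by_cases hx : x ∈ B
      · rw [indicator_of_mem hx]
        simp [cutoff_eq_one hR0 ((mem_closedBall_zero_iff.mp hx).trans hR)]
      · rw [indicator_of_notMem hx]
        exact mul_nonneg (hF0 x) (cutoff_nonneg _ _)
    have h2 : δ * ∫ x, F x * cutoff N R x = ∫ x, pohozaevError a p u (cutoff N R) x :=
      hu.pohozaev ha hp hχ hc
    have h3 : ∫ x, pohozaevError a p u (cutoff N R) x ≤
        ∫ x, K * (annulus N R (2 * R)).indicator (scaledDensity a p u R) x :=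
      integral_mono (hu.integrable_pohozaevError ha hχ hc)
        ((integrable_indicator_annulus (hu.continuous_scaledDensity ha R) _ _).const_mul K)
        fun x => hK R x hR0
    rw [integral_const_mul] at h3
    have h4 := mul_le_mul_of_nonneg_left h1 hδ.le
    linarith
  have hlim := ge_of_tendsto (htend.const_mul K) hle
  rw [mul_zero] at hlim
  exact absurd hlim (not_le.mpr (mul_pos hδ hpos))
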